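/- **Notation.** Let $Q^d=[0,1)^d$. A dyadic cube of $Q^d$ is a set $2^{-j}(Q^d+\alpha)$, with $j\in\{0,1,2,\dots\}$ and $\alpha\in\mathbb Z^d$, that is contained in $Q^d$. For $\lambda>0$ put $k=k(\lambda)=\min\{n\in\mathbb N:\ n>\lambda\}$. For $f\in L_p(Q^d)$ and $t>0$ let $$\omega_k(t;f;L_p)=\sup_{|h|\le t}\Big\|\sum_{j=0}^k(-1)^{k-j}\binom kj f(\cdot+jh)\Big\|_{L_p(Q^d_{kh})},\qquad Q^d_{kh}=\{x\in\mathbb R^d:\ x+jh\in Q^d,\ j=0,\dots,k\}.$$ The homogeneous diagonal Besov space $\dot B_p^{\lambda}$ consists of all real-valued $f\in L_p(Q^d)$ with $$|f|_{B_p^\lambda}=\Big\{\int_0^1\Big(\frac{\omega_k(t;f;L_p)}{t^\lambda}\Big)^p\frac{dt}{t}\Big\}^{1/p}<\infty .$$ **Theorem 2.3.** Let $d\ge 2$, $1\le p<q<\infty$ and $\frac{\lambda}{d}=\frac1p-\frac1q$. There is a constant $c>0$ depending only on $d,\lambda,q$ (hence not on $f$ or $N$; note that $p$ and $k$ are determined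 by $d,\lambda,q$) such that the following holds. For every $f\in\dot B_p^\lambda$ and every integer $N\ge1$ there exist a covering $\Delta_N$ of $Q^d$ by at most $N$ dyadic cubes of $Q^d$ and a piecewise polynomial $$g_N=\sum_{K\in\Delta_N}P_K\cdot 1_K,$$ where each $P_K$ is a polynomial on $\mathbb R^d$ of total degree at most $k(\lambda)-1$, such that $$\|f-g_N\|_{L_q(Q^d)}\le c\,N^{-\lambda/d}\,|f|_{B_p^\lambda}.$$ -/

import Mathlib

open MeasureTheory

noncomputable section

/-- The half-open unit cube `[0,1)^d`. -/
def unitCube (d : ℕ) : Set (EuclideanSpace ℝ (Fin d)) :=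
  {x | ∀ i, 0 ≤ x i ∧ x i < 1}

/-- The dyadic subcubes of the unit cube: the sets `2^{-j}([0,1)^d + α)`, with `j` a natural number
and `α` an integer vector, that are contained in `[0,1)^d`. -/
def dyadicCubes (d : ℕ) : Set (Set (EuclideanSpace ℝ (Fin d))) :=
  {K | K ⊆ unitCube d ∧ ∃ (j : ℕ) (α : Fin d → ℤ),
    K = {x | ∀ i, ((2 : ℝ) ^ j)⁻¹ * (α i : ℝ) ≤ x i ∧ x i < ((2 : ℝ) ^ j)⁻¹ * ((α i : ℝ) + 1)}}

/-- The piecewise polynomials `∑_{K ∈ Δ} P_K · 1_K` of (total) degree at most `l` on a finite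
family `Δ` of sets, which may overlap. -/
def piecewisePolynomials {d : ℕ} (l : ℕ) (Δ : Finset (Set (EuclideanSpace ℝ (Fin d)))) :
    Set (EuclideanSpace ℝ (Fin d) → ℝ) :=
  {g | ∃ P : Set (EuclideanSpace ℝ (Fin d)) → MvPolynomial (Fin d) ℝ,
    (∀ K ∈ Δ, (P K).totalDegree ≤ l) ∧
    g = fun x => ∑ K ∈ Δ, K.indicator (fun y => MvPolynomial.eval (fun i => y i) (P K)) x}

/-- The set of all `x` such that `x + j h` lies in the unit cube for `j = 0, 1, …, k`. -/
def differenceDomain (d k : ℕ) (h : EuclideanSpace ℝ (Fin d)) :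
    Set (EuclideanSpace ℝ (Fin d)) :=
  {x | ∀ j : ℕ, j ≤ k → x + j • h ∈ unitCube d}

/-- The `k`-th modulus of continuity of `f` in `L_p([0,1)^d)`:
the supremum over `|h| ≤ t` of the `L_p` norm of the `k`-th forward difference
`Δ_h^k f(x) = ∑_{j=0}^k (-1)^{k-j} (k choose j) f(x + j h)`,
taken over those `x` for which all the points `x + j h` are in the cube. -/
def modulusOfContinuity {d : ℕ} (k : ℕ) (p : ℝ) (f : EuclideanSpace ℝ (Fin d) → ℝ) (t : ℝ) :
    ENNReal :=
  ⨆ (h : EuclideanSpace ℝ (Fin d)) (_ : ‖h‖ ≤ t),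
    eLpNorm ((fwdDiff h)^[k] f) (ENNReal.ofReal p) (volume.restrict (differenceDomain d k h))

/-- `k(lam) = min {n : n > lam}`. -/
def smoothnessOrder (lam : ℝ) : ℕ := sInf {n : ℕ | lam < (n : ℝ)}

/-- The homogeneous Besov seminorm
`(∫_0^1 (ω_k(t; f; L_p) / t^lam)^θ dt/t)^{1/θ}`, `k = k(lam)`, on the unit cube
(possibly infinite). -/
def besovSeminorm {d : ℕ} (p lam θ : ℝ) (f : EuclideanSpace ℝ (Fin d) → ℝ) : ENNReal :=
  (∫⁻ t in Set.Ioc (0 : ℝ) 1,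
    (modulusOfContinuity (smoothnessOrder lam) p f t / ENNReal.ofReal (t ^ lam)) ^ θ
      / ENNReal.ofReal t) ^ (1 / θ)

/-- The homogeneous Besov space on the unit cube: the functions in `L_p([0,1)^d)` whose Besov
seminorm is finite. The diagonal space is the case `θ = p`. -/
def MemBesov {d : ℕ} (p lam θ : ℝ) (f : EuclideanSpace ℝ (Fin d) → ℝ) : Prop :=
  MemLp f (ENNReal.ofReal p) (volume.restrict (unitCube d)) ∧ besovSeminorm p lam θ f < ⊤

end

/-! The approximant comes from thresholding a multiscale expansion. On every dyadic level f is
approximated cube by cube by polynomials, and the differences between consecutive levels, restricted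
to the finer cubes, are the atoms. Whitney's inequality is used with differences averaged over pairs
of points of a cube (`exists_whitney_cubeAt`), because that right-hand side can be summed over the
disjoint cubes of one level. The sum is bounded by a modulus of continuity
(`exists_dyadic_whitney`), and the weighted sum over levels by the Besov seminorm
(`tsum_modulusOfContinuity_le`). Nikolskii's inequality turns the L_p bounds of the atoms into
pointwise ones: an atom of level j is at most σ^(1/p) 2^(jd/q), and the total A of all σ is at most
a constant times the p-th power of the seminorm. The relation λ/d = 1/p - 1/q is exactly what makes
the weights match (`exists_multiscale`).

The approximant keeps the coarsest polynomial and the atoms with σ > A/N, of which there are fewer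
than N. The unit cube is among the chosen cubes, so they cover it. At a point x the error is a sum
along the chain of dyadic cubes containing x, with terms σ_j^(1/p) 2^(jd/q) and σ_j ≤ ε = A/N. Put
B(x) = ∑ σ_j 2^(jd) over the omitted atoms. Then σ_j ≤ min(ε, B 2^(-jd)), so two geometric series
dominate the terms and the q-th power of the sum is at most a constant times ε^(q/p-1) B(x)
(`tsum_rpow_mul_rpow_le`). The integral of B is at most A, which gives (A/N)^(q/p-1) A
(`exists_dyadic_approximation`); the q-th root is the claimed rate.

Whitney's inequality on the unit cube is proved by operator theory. Averaging the difference at (x,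
y) against a bump in y shows that f equals a smoothed function Sf up to the averaged difference. The
kernel of S is uniformly continuous and the cube is totally bounded, so S is a finite-rank operator
plus one of norm at most 1/2; hence the difference operator controls the distance to its own kernel
(`exists_near_kernel`). A function in that kernel satisfies f = Sf, so it is smooth, and it has
vanishing k-th differences, so it is a polynomial of degree less than k
(`exists_polyFun_of_diffAlong_eq_zero`). -/

noncomputable section

/-! ### Polynomial functions of bounded total degree. -/

/-- Evaluation of polynomials, as a linear map into the functions on Euclidean space. -/
def evalLinearMap (d : ℕ) : MvPolynomial (Fin d) ℝ →ₗ[ℝ] (EuclideanSpace ℝ (Fin d) → ℝ) :=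
  LinearMap.pi fun x => (MvPolynomial.aeval (fun i => x i)).toLinearMap

lemma evalLinearMap_apply {d : ℕ} (P : MvPolynomial (Fin d) ℝ) (x : EuclideanSpace ℝ (Fin d)) :
    evalLinearMap d P x = MvPolynomial.eval (fun i => x i) P := by
  simp [evalLinearMap, MvPolynomial.aeval_eq_eval]

/-- The polynomial functions of total degree at most `l`. -/
def polyFun (d l : ℕ) : Submodule ℝ (EuclideanSpace ℝ (Fin d) → ℝ) :=
  (MvPolynomial.restrictTotalDegree (Fin d) ℝ l).map (evalLinearMap d)

lemma mem_polyFun {d l : ℕ} {g : EuclideanSpace ℝ (Fin d) → ℝ} :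
    g ∈ polyFun d l ↔ ∃ P : MvPolynomial (Fin d) ℝ, P.totalDegree ≤ l ∧
      g = fun x => MvPolynomial.eval (fun i => x i) P := by
  simp only [polyFun, Submodule.mem_map, MvPolynomial.mem_restrictTotalDegree]
  constructor
  · rintro ⟨P, hP, rfl⟩
    exact ⟨P, hP, funext fun x => evalLinearMap_apply P x⟩
  · rintro ⟨P, hP, rfl⟩
    exact ⟨P, hP, funext fun x => evalLinearMap_apply P x⟩

instance (d l : ℕ) : FiniteDimensional ℝ (polyFun d l) := by
  unfold polyFun; infer_instance

lemma continuous_of_mem_polyFun {d l : ℕ} {g : EuclideanSpace ℝ (Fin d) → ℝ}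
    (hg : g ∈ polyFun d l) : Continuous g := by
  obtain ⟨P, -, rfl⟩ := mem_polyFun.1 hg
  exact (MvPolynomial.continuous_eval P).comp (by fun_prop)

lemma totalDegree_bind₁_le_of_forall_le_one {σ ι R : Type*} [CommSemiring R]
    (P : MvPolynomial σ R) (q : σ → MvPolynomial ι R) (hq : ∀ i, (q i).totalDegree ≤ 1) :
    (MvPolynomial.bind₁ q P).totalDegree ≤ P.totalDegree := by
  rw [MvPolynomial.bind₁, MvPolynomial.aeval_def, MvPolynomial.eval₂_eq]
  refine MvPolynomial.totalDegree_finsetSum_le fun m hm => ?_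
  refine (MvPolynomial.totalDegree_mul _ _).trans ?_
  rw [MvPolynomial.algebraMap_eq, MvPolynomial.totalDegree_C, zero_add]
  refine (MvPolynomial.totalDegree_finsetProd _ _).trans ?_
  refine le_trans (Finset.sum_le_sum fun i _ => ?_) (MvPolynomial.le_totalDegree hm)
  refine (MvPolynomial.totalDegree_pow _ _).trans ?_
  simpa using Nat.mul_le_mul_left (m i) (hq i)

/-- This invariance lets inequalities for polynomials pass from the unit cube to every cube with the
same constant. -/
lemma polyFun_comp_affine {d l : ℕ} {g : EuclideanSpace ℝ (Fin d) → ℝ} (hg : g ∈ polyFun d l)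
    (a : EuclideanSpace ℝ (Fin d)) (r : ℝ) : (fun x => g (a + r • x)) ∈ polyFun d l := by
  obtain ⟨P, hP, rfl⟩ := mem_polyFun.1 hg
  refine mem_polyFun.2 ⟨MvPolynomial.bind₁
    (fun i => MvPolynomial.C (a i) + MvPolynomial.C r * MvPolynomial.X i) P,
    (totalDegree_bind₁_le_of_forall_le_one _ _ fun i => ?_).trans hP, ?_⟩
  · refine (MvPolynomial.totalDegree_add _ _).trans ?_
    rw [MvPolynomial.totalDegree_C]
    refine max_le zero_le_one ((MvPolynomial.totalDegree_mul _ _).trans ?_)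
    simp
  · funext x
    simp only [← MvPolynomial.aeval_eq_eval, MvPolynomial.aeval_bind₁]
    congr 2
    funext i
    simp

/-- The open cube is a product of infinite sets, and these determine a polynomial. -/
lemma polyFun_eq_of_eqOn_pi {d l : ℕ} {g : EuclideanSpace ℝ (Fin d) → ℝ} (hg : g ∈ polyFun d l)
    (h : ∀ x : EuclideanSpace ℝ (Fin d), (∀ i, x i ∈ Set.Ioo (0 : ℝ) 1) → g x = 0) : g = 0 := by
  obtain ⟨P, -, rfl⟩ := mem_polyFun.1 hg
  have : P = 0 := MvPolynomial.funext_set (fun _ => Set.Ioo (0 : ℝ) 1)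
    (fun _ => Set.Ioo_infinite one_pos) fun x hx => by
      simpa using h (WithLp.toLp 2 x) (fun i => hx i (Set.mem_univ i))
  funext x
  simp [this]

/-- The value of a multilinear form on the diagonal is a homogeneous polynomial. -/
lemma multilinear_diag_mem_polyFun {d m l : ℕ} (hm : m ≤ l)
    (M : ContinuousMultilinearMap ℝ (fun _ : Fin m => EuclideanSpace ℝ (Fin d)) ℝ) :
    (fun v => M fun _ => v) ∈ polyFun d l := by
  classical
  let b := (EuclideanSpace.basisFun (Fin d) ℝ).toBasis
  refine mem_polyFun.2 ⟨∑ r : Fin m → Fin d,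
    MvPolynomial.C (M fun i => b (r i)) * ∏ i, MvPolynomial.X (r i), ?_, ?_⟩
  · refine MvPolynomial.totalDegree_finsetSum_le fun r _ => ?_
    refine (MvPolynomial.totalDegree_mul _ _).trans ?_
    rw [MvPolynomial.totalDegree_C, zero_add]
    refine (MvPolynomial.totalDegree_finsetProd _ _).trans ?_
    simpa using hm
  · funext v
    have hv : (fun _ : Fin m => v) = fun _ => ∑ j, v j • b j := by
      funext _
      simpa [b] using (b.sum_repr v).symm
    rw [hv, ContinuousMultilinearMap.map_sum]
    simp only [map_sum, map_mul, MvPolynomial.eval_C, map_prod, MvPolynomial.eval_X]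
    refine Finset.sum_congr rfl fun r _ => ?_
    rw [ContinuousMultilinearMap.map_smul_univ, smul_eq_mul, mul_comm]

/-! ### Smooth functions with vanishing differences. -/

lemma iteratedDeriv_comp_line {E : Type*} [NormedAddCommGroup E] [NormedSpace ℝ E] {g : E → ℝ}
    (hg : ContDiff ℝ (⊤ : ℕ∞) g) (c v : E) (m : ℕ) :
    iteratedDeriv m (fun t : ℝ => g (c + t • v)) 0 = iteratedFDeriv ℝ m g c fun _ => v := by
  rw [iteratedDeriv_eq_iteratedFDeriv]
  have h1 : ContDiff ℝ (⊤ : ℕ∞) (fun y => g (c + y)) := hg.comp (contDiff_const.add contDiff_id)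
  have := (ContinuousLinearMap.toSpanSingleton ℝ v).iteratedFDeriv_comp_right (i := m) h1 0
    (by exact_mod_cast le_top)
  have h2 : (fun t : ℝ => g (c + t • v)) =
      (fun y => g (c + y)) ∘ (ContinuousLinearMap.toSpanSingleton ℝ v) := by
    funext t; simp
  rw [h2, this, iteratedFDeriv_comp_add_left]
  simp

/-- This is the k-th difference of x^k with step one, evaluated at 0. -/
lemma sum_choose_pow_eq_factorial (k : ℕ) :
    ∑ j ∈ Finset.range (k + 1), ((-1 : ℝ) ^ (k - j) * (k.choose j : ℝ)) * (j : ℝ) ^ k =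
      (k.factorial : ℝ) := by
  have h := congrFun (fwdDiff_iter_eq_factorial (R := ℝ) (n := k)) 0
  rw [fwdDiff_iter_eq_sum_shift] at h
  simp only [zero_add, nsmul_eq_mul, mul_one, zsmul_eq_mul] at h
  push_cast at h
  simpa using h

/-- Differentiate the difference k times in the step s at s = 0. The node t + js contributes a
factor j^k, so the result is k! times the k-th derivative of G at t. -/
lemma iteratedDeriv_eq_zero_of_fwdDiff_eq_zero {G : ℝ → ℝ} (hG : ContDiff ℝ (⊤ : ℕ∞) G) (k : ℕ)
    (t : ℝ) (h : ∀ᶠ s in nhds (0 : ℝ), (fwdDiff s)^[k] G t = 0) : iteratedDeriv k G t = 0 := by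
  have h1 : (fun s : ℝ => ∑ j ∈ Finset.range (k + 1),
      ((-1 : ℝ) ^ (k - j) * (k.choose j : ℝ)) * G (t + (j : ℝ) * s)) =ᶠ[nhds 0] fun _ => 0 := by
    filter_upwards [h] with s hs
    rw [fwdDiff_iter_eq_sum_shift] at hs
    simpa [zsmul_eq_mul, nsmul_eq_mul] using hs
  have hGt : ContDiff ℝ (⊤ : ℕ∞) (fun s => G (t + s)) := hG.comp (contDiff_const.add contDiff_id)
  have h2 := h1.iteratedDeriv_eq k
  have h3 : ∀ j : ℕ, ContDiff ℝ (⊤ : ℕ∞) (fun s : ℝ => G (t + (j : ℝ) * s)) := fun j =>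
    hG.comp (contDiff_const.add (contDiff_const.mul contDiff_id))
  have h4 : ∀ j : ℕ, iteratedDeriv k (fun s : ℝ => G (t + (j : ℝ) * s)) 0 =
      (j : ℝ) ^ k * iteratedDeriv k G t := by
    intro j
    have := congrFun (iteratedDeriv_comp_const_mul (n := k) (f := fun s => G (t + s))
      (hGt.of_le (by exact_mod_cast le_top)) (j : ℝ)) 0
    rw [this, iteratedDeriv_comp_const_add]
    simp
  rw [iteratedDeriv_fun_sum (fun j _ => (contDiffAt_const.mul
    ((h3 j).contDiffAt.of_le (by exact_mod_cast le_top))))] at h2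
  have h5 : ∀ j ∈ Finset.range (k + 1), iteratedDeriv k (fun s : ℝ =>
      ((-1 : ℝ) ^ (k - j) * (k.choose j : ℝ)) * G (t + (j : ℝ) * s)) 0 =
      (((-1 : ℝ) ^ (k - j) * (k.choose j : ℝ)) * (j : ℝ) ^ k) * iteratedDeriv k G t := by
    intro j _
    rw [iteratedDeriv_const_mul _ ((h3 j).contDiffAt.of_le (by exact_mod_cast le_top)), h4]
    ring
  rw [Finset.sum_congr rfl h5, ← Finset.sum_mul, sum_choose_pow_eq_factorial] at h2
  have h6 : iteratedDeriv k (fun _ : ℝ => (0 : ℝ)) 0 = 0 := by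
    simp
  rw [h6] at h2
  exact (mul_eq_zero.1 h2).resolve_left (by positivity)

lemma eq_sum_of_iteratedDeriv_eq_zero {G : ℝ → ℝ} (hG : ContDiff ℝ (⊤ : ℕ∞) G) {k : ℕ}
    (hk : 1 ≤ k) (h : ∀ t ∈ Set.Ioo (0 : ℝ) 1, iteratedDeriv k G t = 0) :
    G 1 = ∑ m ∈ Finset.range k, (m.factorial : ℝ)⁻¹ * iteratedDeriv m G 0 := by
  obtain ⟨n, rfl⟩ : ∃ n, k = n + 1 := ⟨k - 1, by omega⟩
  obtain ⟨x', hx', he⟩ := taylor_mean_remainder_lagrange_iteratedDeriv (f := G) (x := 1) (x₀ := 0)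
    (n := n) (by norm_num) ((hG.of_le (by exact_mod_cast le_top)).contDiffOn)
  rw [Set.uIoo_of_le zero_le_one] at hx'
  rw [h x' hx', zero_mul, zero_div, sub_eq_zero] at he
  rw [he, taylor_within_apply]
  refine Finset.sum_congr rfl fun m _ => ?_
  rw [iteratedDerivWithin_eq_iteratedDeriv (uniqueDiffOn_uIcc (by norm_num))
    (hG.contDiffAt.of_le (by exact_mod_cast le_top)) (by simp)]
  simp

/-- A smooth function whose `k`-th differences with small steps vanish on an open set that is
star-shaped about `c` is a polynomial of degree less than `k` there. -/
lemma exists_polyFun_of_fwdDiff_eq_zero {d k : ℕ} (hk : 1 ≤ k)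
    {g : EuclideanSpace ℝ (Fin d) → ℝ} (hg : ContDiff ℝ (⊤ : ℕ∞) g)
    {U : Set (EuclideanSpace ℝ (Fin d))} {c : EuclideanSpace ℝ (Fin d)} (hc : StarConvex ℝ c U)
    (h : ∀ x ∈ U, ∀ v, ∀ᶠ s in nhds (0 : ℝ), (fwdDiff (s • v))^[k] g x = 0) :
    ∃ P ∈ polyFun d (k - 1), ∀ x ∈ U, g x = P x := by
  -- The witness is the Taylor polynomial of degree k - 1 at c, evaluated at x - c.
  refine ⟨fun x => (∑ m ∈ Finset.range k, (m.factorial : ℝ)⁻¹ •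
    fun v => iteratedFDeriv ℝ m g c fun _ => v) (-c + (1 : ℝ) • x), polyFun_comp_affine
      (Submodule.sum_mem _ fun m hm => Submodule.smul_mem _ _
        (multilinear_diag_mem_polyFun (by have := Finset.mem_range.1 hm; omega) _)) _ _, ?_⟩
  intro x hx
  have hG : ContDiff ℝ (⊤ : ℕ∞) (fun t : ℝ => g (c + t • (x - c))) :=
    hg.comp (contDiff_const.add (contDiff_id.smul contDiff_const))
  have key := eq_sum_of_iteratedDeriv_eq_zero hG hk fun t ht => ?_
  · simp only [one_smul, add_sub_cancel] at key
    simp only [key, Finset.sum_apply]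
    refine Finset.sum_congr rfl fun m _ => ?_
    rw [iteratedDeriv_comp_line hg]
    simp only [Pi.smul_apply, smul_eq_mul, one_smul]
    rw [neg_add_eq_sub]
  · refine iteratedDeriv_eq_zero_of_fwdDiff_eq_zero hG k t ?_
    have hxt : c + t • (x - c) ∈ U := by
      have := hc hx (a := 1 - t) (b := t) (by linarith [ht.2]) ht.1.le (by ring)
      convert this using 1
      module
    -- A step s along the segment is the step s • (x - c) in space.
    filter_upwards [h _ hxt (x - c)] with s hs
    rw [fwdDiff_iter_eq_sum_shift] at hs ⊢
    rw [← hs]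
    refine Finset.sum_congr rfl fun j _ => ?_
    congr 2
    simp only [nsmul_eq_mul]
    module

/-! ### Distance to the kernel of an operator, and integral operators on L_p. -/

/-- A bounded operator that is bounded below modulo a finite-rank operator and a small one
controls the distance to its kernel. -/
lemma exists_near_kernel {X Y : Type*} [NormedAddCommGroup X] [NormedSpace ℝ X] [CompleteSpace X]
    [NormedAddCommGroup Y] [NormedSpace ℝ Y] (D : X →L[ℝ] Y) (F R : X →L[ℝ] X)
    (hF : FiniteDimensional ℝ (LinearMap.range F.toLinearMap)) (hR : ‖R‖ < 1) (C₀ : ℝ)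
    (h : ∀ x, ‖x - (F x + R x)‖ ≤ C₀ * ‖D x‖) :
    ∃ C : ℝ, ∀ x, ∃ u, D u = 0 ∧ ‖x - u‖ ≤ C * ‖D x‖ := by
  -- By the Neumann series 1 - R is invertible. With B its inverse, x - B(Fx) = B(x - Fx - Rx), so x
  -- is close to the finite-dimensional space V.
  let A : (X →L[ℝ] X)ˣ := Units.oneSub R hR
  let B : X →L[ℝ] X := ↑A⁻¹
  have hBA : ∀ x, B (x - R x) = x := fun x => by
    have : (↑A⁻¹ * (A : X →L[ℝ] X)) x = x := by rw [Units.inv_mul]; rfl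
    exact this
  let V : Submodule ℝ X := (LinearMap.range F.toLinearMap).map B.toLinearMap
  have hV : FiniteDimensional ℝ V := by infer_instance
  let DV : V →ₗ[ℝ] Y := D.toLinearMap.comp V.subtype
  -- On V the image of D is finite-dimensional, so a linear right inverse is automatically bounded.
  -- It supplies a small w with Dw = Dv, and v - w lies in the kernel.
  obtain ⟨r, hr⟩ := DV.rangeRestrict.exists_rightInverse_of_surjective
    (LinearMap.range_rangeRestrict DV)
  let r' : LinearMap.range DV →L[ℝ] V := LinearMap.toContinuousLinearMap r
  refine ⟨‖B‖ * C₀ + ‖r'‖ * (1 + ‖D‖ * (‖B‖ * C₀)), fun x => ?_⟩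
  have hvm : B (F x) ∈ V := Submodule.mem_map_of_mem (LinearMap.mem_range_self F.toLinearMap x)
  set v : V := ⟨B (F x), hvm⟩ with hv
  have hxv : ‖x - v‖ ≤ ‖B‖ * C₀ * ‖D x‖ := by
    have : x - v = B (x - (F x + R x)) := by
      rw [show x - (F x + R x) = (x - R x) - F x by abel, map_sub, hBA]
    rw [this, mul_assoc]
    exact (B.le_opNorm _).trans (mul_le_mul_of_nonneg_left (h x) (norm_nonneg _))
  set w : V := r (DV.rangeRestrict v) with hw
  have hDw : D w = D v := by
    have := LinearMap.congr_fun hr (DV.rangeRestrict v)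
    exact congrArg Subtype.val this
  have hwn : ‖w‖ ≤ ‖r'‖ * ‖D v‖ := r'.le_opNorm (DV.rangeRestrict v)
  have hDv : ‖D v‖ ≤ (1 + ‖D‖ * (‖B‖ * C₀)) * ‖D x‖ := by
    have h1 : D v = D x - D (x - v) := by rw [map_sub]; abel
    rw [h1]
    refine (norm_sub_le _ _).trans ?_
    have := (D.le_opNorm (x - v)).trans (mul_le_mul_of_nonneg_left hxv (norm_nonneg _))
    linarith
  refine ⟨(v : X) - w, by rw [map_sub, hDw, sub_self], ?_⟩
  have h2 : x - ((v : X) - w) = (x - v) + w := by abel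
  rw [h2]
  refine (norm_add_le _ _).trans ?_
  have h3 := mul_le_mul_of_nonneg_left hDv (norm_nonneg r')
  have h4 : ‖(w : X)‖ = ‖w‖ := rfl
  rw [h4]
  linarith

section LpOperators

variable {α β : Type*} [MeasurableSpace α] [MeasurableSpace β] {p : ENNReal} [Fact (1 ≤ p)]

/-- Composition with a map under which the image of `ν` is at most a multiple of `μ`. -/
def compLp {μ : Measure α} {ν : Measure β} {m : β → α} (hm : Measurable m) {c : ENNReal}
    (hc : c ≠ ⊤) (h : ν.map m ≤ c • μ) : Lp ℝ p μ →L[ℝ] Lp ℝ p ν :=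
  (Lp.compMeasurePreservingₗᵢ ℝ m ⟨hm, rfl⟩).toContinuousLinearMap ∘L
    Lp.LpToLpOfMeasureLeSMul hc h

lemma coeFn_compLp {μ : Measure α} {ν : Measure β} {m : β → α} (hm : Measurable m) {c : ENNReal}
    (hc : c ≠ ⊤) (h : ν.map m ≤ c • μ) (f : Lp ℝ p μ) :
    compLp hm hc h f =ᵐ[ν] f ∘ m := by
  refine (Lp.coeFn_compMeasurePreserving (Lp.LpToLpOfMeasureLeSMul hc h f) ⟨hm, rfl⟩).trans ?_
  exact ae_eq_comp hm.aemeasurable (Lp.coeFn_LpToLpOfMeasureLeSMul hc h f)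

variable {μ : Measure α} [IsProbabilityMeasure μ]

lemma integral_norm_le_norm_Lp (f : Lp ℝ p μ) : ∫ z, ‖f z‖ ∂μ ≤ ‖f‖ := by
  have h1 : eLpNorm f 1 μ ≤ eLpNorm f p μ :=
    eLpNorm_le_eLpNorm_of_exponent_le Fact.out (Lp.aestronglyMeasurable f)
  rw [Lp.norm_def, integral_norm_eq_lintegral_enorm (Lp.aestronglyMeasurable f),
    ← eLpNorm_one_eq_lintegral_enorm]
  exact ENNReal.toReal_mono (Lp.eLpNorm_ne_top f) h1

lemma integrable_Lp (f : Lp ℝ p μ) : Integrable f μ :=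
  (Lp.memLp f).integrable Fact.out

lemma integrable_kernel_mul {κ : α → α → ℝ} (hκ : Measurable (Function.uncurry κ)) {M : ℝ} {x : α}
    (hx : ∀ z, |κ x z| ≤ M) (f : Lp ℝ p μ) : Integrable (fun z => κ x z * f z) μ :=
  (integrable_Lp f).bdd_mul (c := M)
    (hκ.comp measurable_prodMk_left).aestronglyMeasurable
    (Filter.Eventually.of_forall fun z => by simpa using hx z)

lemma norm_kernel_integral_le {κ : α → α → ℝ} {M : ℝ} {x : α}
    (hx : ∀ z, |κ x z| ≤ M) (f : Lp ℝ p μ) : ‖∫ z, κ x z * f z ∂μ‖ ≤ M * ‖f‖ := by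
  by_cases hα : Nonempty α
  · obtain ⟨z₀⟩ := hα
    have hM : 0 ≤ M := (abs_nonneg _).trans (hx z₀)
    calc ‖∫ z, κ x z * f z ∂μ‖ ≤ ∫ z, M * ‖f z‖ ∂μ := by
          refine norm_integral_le_of_norm_le ((integrable_Lp f).norm.const_mul M)
            (Filter.Eventually.of_forall fun z => ?_)
          rw [norm_mul]
          exact mul_le_mul_of_nonneg_right (hx z) (norm_nonneg _)
      _ = M * ∫ z, ‖f z‖ ∂μ := integral_const_mul _ _
      _ ≤ M * ‖f‖ := mul_le_mul_of_nonneg_left (integral_norm_le_norm_Lp f) hM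
  · exact (hα ⟨x⟩).elim

lemma memLp_kernel_integral {κ : α → α → ℝ} (hκ : Measurable (Function.uncurry κ)) {M : ℝ}
    (hM : ∀ᵐ x ∂μ, ∀ z, |κ x z| ≤ M) (f : Lp ℝ p μ) :
    MemLp (fun x => ∫ z, κ x z * f z ∂μ) p μ := by
  refine MemLp.of_bound (C := M * ‖f‖) ?_ ?_
  · have h : StronglyMeasurable (Function.uncurry fun x z => κ x z * f z) :=
      hκ.stronglyMeasurable.mul ((Lp.stronglyMeasurable f).comp_measurable measurable_snd)
    exact h.integral_prod_right.aestronglyMeasurable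
  · filter_upwards [hM] with x hx using norm_kernel_integral_le hx f

lemma norm_toLp_kernel_integral_le {κ : α → α → ℝ} (hκ : Measurable (Function.uncurry κ)) {M : ℝ}
    (hM : ∀ᵐ x ∂μ, ∀ z, |κ x z| ≤ M) (hM0 : 0 ≤ M) (f : Lp ℝ p μ) :
    ‖(memLp_kernel_integral hκ hM f).toLp (fun x => ∫ z, κ x z * f z ∂μ)‖ ≤ M * ‖f‖ := by
  rw [Lp.norm_toLp]
  refine ENNReal.toReal_le_of_le_ofReal (by positivity) ?_
  refine (eLpNorm_le_of_ae_bound (C := M * ‖f‖) ?_).trans (by simp)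
  filter_upwards [hM] with x hx using norm_kernel_integral_le hx f

/-- The integral operator with an essentially bounded kernel. -/
def kernelOp (κ : α → α → ℝ) (hκ : Measurable (Function.uncurry κ)) (M : ℝ) (hM0 : 0 ≤ M)
    (hM : ∀ᵐ x ∂μ, ∀ z, |κ x z| ≤ M) : Lp ℝ p μ →L[ℝ] Lp ℝ p μ :=
  LinearMap.mkContinuous
    { toFun := fun f => (memLp_kernel_integral hκ hM f).toLp (fun x => ∫ z, κ x z * f z ∂μ)
      map_add' := fun f g => by
        rw [← MemLp.toLp_add]
        refine MemLp.toLp_congr _ _ ?_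
        filter_upwards [hM] with x hx
        simp only [Pi.add_apply]
        rw [← integral_add (integrable_kernel_mul hκ hx f) (integrable_kernel_mul hκ hx g)]
        refine integral_congr_ae ?_
        filter_upwards [Lp.coeFn_add f g] with z hz
        rw [hz, Pi.add_apply, mul_add]
      map_smul' := fun c f => by
        rw [RingHom.id_apply, ← MemLp.toLp_const_smul]
        refine MemLp.toLp_congr _ _ (Filter.Eventually.of_forall fun x => ?_)
        simp only [Pi.smul_apply, smul_eq_mul]
        rw [← integral_const_mul]
        refine integral_congr_ae ?_
        filter_upwards [Lp.coeFn_smul c f] with z hz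
        rw [hz, Pi.smul_apply, smul_eq_mul]
        ring } M fun f => norm_toLp_kernel_integral_le hκ hM hM0 f

lemma coeFn_kernelOp {κ : α → α → ℝ} (hκ : Measurable (Function.uncurry κ)) {M : ℝ} (hM0 : 0 ≤ M)
    (hM : ∀ᵐ x ∂μ, ∀ z, |κ x z| ≤ M) (f : Lp ℝ p μ) :
    kernelOp κ hκ M hM0 hM f =ᵐ[μ] fun x => ∫ z, κ x z * f z ∂μ :=
  MemLp.coeFn_toLp (memLp_kernel_integral hκ hM f)

lemma norm_kernelOp_le {κ : α → α → ℝ} (hκ : Measurable (Function.uncurry κ)) {M : ℝ}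
    (hM0 : 0 ≤ M) (hM : ∀ᵐ x ∂μ, ∀ z, |κ x z| ≤ M) :
    ‖kernelOp (p := p) κ hκ M hM0 hM‖ ≤ M :=
  ContinuousLinearMap.opNorm_le_bound _ hM0 (norm_toLp_kernel_integral_le hκ hM hM0)

/-- An integral operator whose kernel is a step function of the first variable has finite rank. -/
lemma finiteDimensional_range_kernelOp (κ : α → α → ℝ) (s : SimpleFunc α α)
    (hκ : Measurable (Function.uncurry fun x z => κ (s x) z)) (M : ℝ) (hM0 : 0 ≤ M)
    (hM : ∀ᵐ x ∂μ, ∀ z, |κ (s x) z| ≤ M) :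
    FiniteDimensional ℝ (LinearMap.range
      (kernelOp (p := p) (fun x z => κ (s x) z) hκ M hM0 hM).toLinearMap) := by
  classical
  -- The range is spanned by the indicators of the finitely many fibres of `s`.
  let b : α → Lp ℝ p μ := fun c =>
    indicatorConstLp p (s.measurableSet_fiber c) (measure_ne_top μ _) (1 : ℝ)
  have : LinearMap.range (kernelOp (p := p) (fun x z => κ (s x) z) hκ M hM0 hM).toLinearMap ≤
      Submodule.span ℝ (s.range.image b : Set (Lp ℝ p μ)) := by
    rintro _ ⟨f, rfl⟩
    have hf : kernelOp (p := p) (fun x z => κ (s x) z) hκ M hM0 hM f =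
        ∑ c ∈ s.range, (∫ z, κ c z * f z ∂μ) • b c := by
      refine Lp.ext ?_
      have h1 : ∀ᵐ x ∂μ, ∀ c ∈ s.range, ((∫ z, κ c z * f z ∂μ) • b c : Lp ℝ p μ) x =
          (∫ z, κ c z * f z ∂μ) * (s ⁻¹' {c}).indicator (fun _ => (1 : ℝ)) x := by
        rw [Filter.eventually_all_finset]
        intro c _
        filter_upwards [Lp.coeFn_smul (∫ z, κ c z * f z ∂μ) (b c),
          indicatorConstLp_coeFn (p := p) (hs := s.measurableSet_fiber c)
            (hμs := measure_ne_top μ _) (c := (1 : ℝ))] with x hx1 hx2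
        rw [hx1, Pi.smul_apply, smul_eq_mul, hx2]
      filter_upwards [coeFn_kernelOp (p := p) hκ hM0 hM f, h1,
        Lp.coeFn_finsetSum s.range fun c => (∫ z, κ c z * f z ∂μ) • b c] with x hx1 hx2 hx3
      rw [hx1, hx3, Finset.sum_apply, Finset.sum_congr rfl hx2,
        Finset.sum_eq_single_of_mem (s x) (s.mem_range_self x)]
      · simp
      · intro c _ hc
        rw [Set.indicator_of_notMem (by simpa using hc.symm), mul_zero]
    change kernelOp (p := p) (fun x z => κ (s x) z) hκ M hM0 hM f ∈ _
    rw [hf]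
    refine Submodule.sum_mem _ fun c hc => Submodule.smul_mem _ _ (Submodule.subset_span ?_)
    exact Finset.mem_coe.2 (Finset.mem_image_of_mem b hc)
  have hfin : FiniteDimensional ℝ (Submodule.span ℝ (s.range.image b : Set (Lp ℝ p μ))) :=
    FiniteDimensional.span_finset ℝ _
  exact Submodule.finiteDimensional_of_le this

end LpOperators

/-! ### Cubes and affine changes of variables. -/

/-- The half-open cube with lower corner `a` and side length `r`. -/
def cubeAt {d : ℕ} (a : EuclideanSpace ℝ (Fin d)) (r : ℝ) : Set (EuclideanSpace ℝ (Fin d)) :=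
  {x | ∀ i, a i ≤ x i ∧ x i < a i + r}

lemma unitCube_eq_cubeAt (d : ℕ) : unitCube d = cubeAt 0 1 := by
  ext x; simp [unitCube, cubeAt]

lemma measurableSet_cubeAt {d : ℕ} (a : EuclideanSpace ℝ (Fin d)) (r : ℝ) :
    MeasurableSet (cubeAt a r) := by
  have : cubeAt a r = ⋂ i, ((fun x : EuclideanSpace ℝ (Fin d) => x i) ⁻¹'
      Set.Ico (a i) (a i + r)) := by
    ext x; simp [cubeAt]
  rw [this]
  exact MeasurableSet.iInter fun i => measurableSet_Ico.preimage (by fun_prop)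

lemma measurableSet_unitCube (d : ℕ) : MeasurableSet (unitCube d) :=
  unitCube_eq_cubeAt d ▸ measurableSet_cubeAt _ _

lemma affine_mem_cubeAt_iff {d : ℕ} (a : EuclideanSpace ℝ (Fin d)) {r : ℝ} (hr : 0 < r)
    (y : EuclideanSpace ℝ (Fin d)) : a + r • y ∈ cubeAt a r ↔ y ∈ unitCube d := by
  simp only [cubeAt, unitCube, Set.mem_ofPred_eq, PiLp.add_apply, PiLp.smul_apply, smul_eq_mul]
  refine forall_congr' fun i => and_congr ?_ ?_
  · simp [hr]
  · rw [add_lt_add_iff_left, mul_lt_iff_lt_one_right hr]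

lemma mix_mem_cubeAt {d : ℕ} {a : EuclideanSpace ℝ (Fin d)} {r : ℝ}
    {x y : EuclideanSpace ℝ (Fin d)} (hx : x ∈ cubeAt a r) (hy : y ∈ cubeAt a r) {s : ℝ}
    (hs0 : 0 ≤ s) (hs1 : s ≤ 1) : x + s • (y - x) ∈ cubeAt a r := by
  intro i
  simp only [PiLp.add_apply, PiLp.smul_apply, PiLp.sub_apply, smul_eq_mul]
  obtain ⟨h1, h2⟩ := hx i
  obtain ⟨h3, h4⟩ := hy i
  constructor
  · nlinarith
  · rcases hs1.eq_or_lt with rfl | hs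
    · linarith
    · nlinarith

lemma norm_sub_le_of_mem_cubeAt {d : ℕ} {a : EuclideanSpace ℝ (Fin d)} {r : ℝ}
    {x y : EuclideanSpace ℝ (Fin d)} (hx : x ∈ cubeAt a r) (hy : y ∈ cubeAt a r) (hr : 0 ≤ r) :
    ‖y - x‖ ≤ d * r := by
  -- The diagonal bound is afterwards weakened from √d to d, which keeps square roots out of later
  -- constants.
  have h1 : ‖y - x‖ ≤ √d * r := by
    rw [EuclideanSpace.norm_eq, Real.sqrt_le_left (by positivity), mul_pow,
      Real.sq_sqrt (by positivity)]
    calc ∑ i, ‖(y - x) i‖ ^ 2 ≤ ∑ _i : Fin d, r ^ 2 := by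
          refine Finset.sum_le_sum fun i _ => ?_
          rw [Real.norm_eq_abs, PiLp.sub_apply]
          refine pow_le_pow_left₀ (abs_nonneg _) (abs_le.2 ⟨?_, ?_⟩) 2
          · linarith [(hx i).2, (hy i).1]
          · linarith [(hx i).1, (hy i).2]
      _ = d * r ^ 2 := by simp
  refine h1.trans (mul_le_mul_of_nonneg_right ?_ hr)
  rw [Real.sqrt_le_left (by positivity)]
  rcases Nat.eq_zero_or_pos d with rfl | hd
  · simp
  · have : (1 : ℝ) ≤ d := by exact_mod_cast hd
    nlinarith

lemma lintegral_affine {d : ℕ} (g : EuclideanSpace ℝ (Fin d) → ENNReal)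
    (a : EuclideanSpace ℝ (Fin d)) {r : ℝ} (hr : 0 < r) :
    ∫⁻ y, g (a + r • y) = ENNReal.ofReal ((r ^ d)⁻¹) * ∫⁻ y, g y := by
  have h1 : ∫⁻ y, g (a + r • y) = ∫⁻ z, g (a + z) ∂(Measure.map (r • ·) volume) :=
    (lintegral_map_equiv (fun z => g (a + z))
      (Homeomorph.smul (isUnit_iff_ne_zero.2 hr.ne').unit).toMeasurableEquiv).symm
  rw [h1, Measure.map_addHaar_smul volume hr.ne', lintegral_smul_measure,
    lintegral_add_left_eq_self, finrank_euclideanSpace_fin, abs_of_pos (by positivity), smul_eq_mul]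

lemma setLIntegral_affine {d : ℕ} (g : EuclideanSpace ℝ (Fin d) → ENNReal)
    (a : EuclideanSpace ℝ (Fin d)) {r : ℝ} (hr : 0 < r) :
    ∫⁻ y in unitCube d, g (a + r • y) =
      ENNReal.ofReal ((r ^ d)⁻¹) * ∫⁻ z in cubeAt a r, g z := by
  rw [← lintegral_indicator (measurableSet_unitCube d),
    ← lintegral_indicator (measurableSet_cubeAt a r), ← lintegral_affine _ a hr]
  refine lintegral_congr fun y => ?_
  by_cases hy : y ∈ unitCube d
  · rw [Set.indicator_of_mem hy, Set.indicator_of_mem ((affine_mem_cubeAt_iff a hr y).2 hy)]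
  · rw [Set.indicator_of_notMem hy,
      Set.indicator_of_notMem (mt (affine_mem_cubeAt_iff a hr y).1 hy)]

lemma volume_unitCube (d : ℕ) : volume (unitCube d) = 1 := by
  have h := (EuclideanSpace.volume_preserving_symm_measurableEquiv_toLp (Fin d))
  have h2 : unitCube d = (MeasurableEquiv.toLp 2 (Fin d → ℝ)).symm ⁻¹'
      (Set.univ.pi fun _ => Set.Ico (0 : ℝ) 1) := by
    ext x; simp [unitCube]
  rw [h2, h.measure_preimage_equiv, Real.volume_pi_Ico]
  simp

lemma volume_cubeAt {d : ℕ} (a : EuclideanSpace ℝ (Fin d)) {r : ℝ} (hr : 0 < r) :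
    volume (cubeAt a r) = ENNReal.ofReal (r ^ d) := by
  have h := setLIntegral_affine (fun _ => 1) a hr
  rw [setLIntegral_one, setLIntegral_one, volume_unitCube] at h
  calc volume (cubeAt a r)
      = ENNReal.ofReal (r ^ d) * (ENNReal.ofReal ((r ^ d)⁻¹) * volume (cubeAt a r)) := by
        rw [← mul_assoc, ← ENNReal.ofReal_mul (by positivity), mul_inv_cancel₀ (by positivity),
          ENNReal.ofReal_one, one_mul]
    _ = ENNReal.ofReal (r ^ d) := by rw [← h, mul_one]

/-! ### Differences along segments, as operators on the unit cube. -/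

/-- Lebesgue measure on the unit cube. -/
abbrev cubeMeasure (d : ℕ) : Measure (EuclideanSpace ℝ (Fin d)) := volume.restrict (unitCube d)

instance (d : ℕ) : IsProbabilityMeasure (cubeMeasure d) :=
  ⟨by rw [Measure.restrict_apply_univ, volume_unitCube]⟩

/-- The point `x + s (y - x)`. -/
def mixMap {d : ℕ} (s : ℝ) (z : EuclideanSpace ℝ (Fin d) × EuclideanSpace ℝ (Fin d)) :
    EuclideanSpace ℝ (Fin d) := z.1 + s • (z.2 - z.1)

lemma continuous_mixMap {d : ℕ} (s : ℝ) : Continuous (mixMap (d := d) s) := by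
  unfold mixMap; fun_prop

/-- The density bound for the image of the product measure under `mixMap s`. -/
def mixConst (d : ℕ) (s : ℝ) : ENNReal := if s = 0 then 1 else ENNReal.ofReal ((s ^ d)⁻¹)

lemma mixConst_ne_top (d : ℕ) (s : ℝ) : mixConst d s ≠ ⊤ := by
  unfold mixConst; split_ifs <;> simp

/-- For s > 0 and fixed x, the map y ↦ (1 - s)x + sy scales volume by s^d and keeps the cube inside
itself by convexity. For s = 0 it is the projection to x, which preserves the measure. -/
lemma map_mixMap_le {d : ℕ} {s : ℝ} (hs0 : 0 ≤ s) (hs1 : s ≤ 1) :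
    ((cubeMeasure d).prod (cubeMeasure d)).map (mixMap s) ≤ mixConst d s • cubeMeasure d := by
  refine Measure.le_iff.2 fun A hA => ?_
  rw [Measure.map_apply (continuous_mixMap s).measurable hA,
    Measure.prod_apply ((continuous_mixMap s).measurable hA), Measure.smul_apply, smul_eq_mul]
  have key : ∀ x ∈ unitCube d, cubeMeasure d (Prod.mk x ⁻¹' (mixMap s ⁻¹' A)) ≤
      if s = 0 then A.indicator (fun _ => 1) x else mixConst d s * cubeMeasure d A := by
    intro x hx
    split_ifs with h
    · subst h
      by_cases hxA : x ∈ A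
      · rw [Set.indicator_of_mem hxA]; exact prob_le_one
      · have : Prod.mk x ⁻¹' (mixMap (d := d) 0 ⁻¹' A) = ∅ := by
          ext y; simp [mixMap, hxA]
        rw [this]; simp
    · have hs : 0 < s := lt_of_le_of_ne hs0 (Ne.symm h)
      rw [Measure.restrict_apply hA, ← lintegral_indicator_one
          (hA.inter (measurableSet_unitCube d)), mixConst, if_neg h,
        ← lintegral_affine _ ((1 - s) • x) hs, Measure.restrict_apply
          (measurable_prodMk_left ((continuous_mixMap s).measurable hA)),
        ← lintegral_indicator_one ((measurable_prodMk_left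
          ((continuous_mixMap s).measurable hA)).inter (measurableSet_unitCube d))]
      refine lintegral_mono (Set.indicator_le fun y hy => ?_)
      have he : (1 - s) • x + s • y = x + s • (y - x) := by module
      have hmem : x + s • (y - x) ∈ A ∩ unitCube d := by
        refine ⟨hy.1, ?_⟩
        have hy2 := hy.2
        rw [unitCube_eq_cubeAt] at hx hy2 ⊢
        exact mix_mem_cubeAt hx hy2 hs0 hs1
      rw [he, Set.indicator_of_mem hmem]
      rfl
  calc ∫⁻ x, cubeMeasure d (Prod.mk x ⁻¹' (mixMap s ⁻¹' A)) ∂cubeMeasure d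
      ≤ ∫⁻ x, (if s = 0 then A.indicator (fun _ => 1) x
          else mixConst d s * cubeMeasure d A) ∂cubeMeasure d :=
        setLIntegral_mono' (measurableSet_unitCube d) key
    _ ≤ mixConst d s * cubeMeasure d A := by
        split_ifs with h
        · rw [mixConst, if_pos h, one_mul]
          exact (lintegral_indicator_one hA).le
        · simp

/-- The `L_p` space of the product of two cubes receives compositions with `mixMap s`. -/
def mixOp {d : ℕ} (p : ENNReal) [Fact (1 ≤ p)] (s : ℝ) (hs0 : 0 ≤ s) (hs1 : s ≤ 1) :
    Lp ℝ p (cubeMeasure d) →L[ℝ] Lp ℝ p ((cubeMeasure d).prod (cubeMeasure d)) :=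
  compLp (continuous_mixMap s).measurable (mixConst_ne_top d s) (map_mixMap_le hs0 hs1)

lemma ae_comp_mixMap {d : ℕ} {s : ℝ} (hs0 : 0 ≤ s) (hs1 : s ≤ 1)
    {f g : EuclideanSpace ℝ (Fin d) → ℝ} (h : f =ᵐ[cubeMeasure d] g) :
    f ∘ mixMap s =ᵐ[(cubeMeasure d).prod (cubeMeasure d)] g ∘ mixMap s :=
  ae_eq_comp (continuous_mixMap s).aemeasurable
    ((Measure.absolutelyContinuous_of_le_smul (map_mixMap_le hs0 hs1)).ae_eq h)

/-- The `k`-th difference at `x` with step `τ (y - x)`, as a function of the pair `(x, y)`. -/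
def diffAlong {d : ℕ} (k : ℕ) (τ : ℝ) (f : EuclideanSpace ℝ (Fin d) → ℝ)
    (z : EuclideanSpace ℝ (Fin d) × EuclideanSpace ℝ (Fin d)) : ℝ :=
  (fwdDiff (τ • (z.2 - z.1)))^[k] f z.1

/-- The coefficients of the `k`-th difference. -/
def diffCoeff (k j : ℕ) : ℝ := (-1) ^ (k - j) * (k.choose j : ℝ)

lemma diffAlong_eq_sum {d : ℕ} (k : ℕ) (τ : ℝ) (f : EuclideanSpace ℝ (Fin d) → ℝ)
    (z : EuclideanSpace ℝ (Fin d) × EuclideanSpace ℝ (Fin d)) :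
    diffAlong k τ f z = ∑ j : Fin (k + 1), diffCoeff k j * f (mixMap (j * τ) z) := by
  rw [diffAlong, fwdDiff_iter_eq_sum_shift, Finset.sum_range]
  refine Finset.sum_congr rfl fun j _ => ?_
  rw [zsmul_eq_mul, mixMap, diffCoeff]
  push_cast
  congr 2
  rw [← Nat.cast_smul_eq_nsmul ℝ, smul_smul]

/-- Admissibility of the step parameter: all nodes of the difference lie between `x` and `y`. -/
lemma node_bounds {k : ℕ} {τ : ℝ} (hτ : 0 < τ) (hkτ : k * τ ≤ 1) (j : Fin (k + 1)) :
    0 ≤ (j : ℝ) * τ ∧ (j : ℝ) * τ ≤ 1 := by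
  refine ⟨by positivity, le_trans ?_ hkτ⟩
  have : ((j : ℕ) : ℝ) ≤ k := by exact_mod_cast Nat.lt_succ_iff.1 j.2
  gcongr

/-- The `k`-th difference as a bounded operator on `L_p` of the unit cube. -/
def diffOp {d : ℕ} (p : ENNReal) [Fact (1 ≤ p)] {k : ℕ} {τ : ℝ} (hτ : 0 < τ) (hkτ : k * τ ≤ 1) :
    Lp ℝ p (cubeMeasure d) →L[ℝ] Lp ℝ p ((cubeMeasure d).prod (cubeMeasure d)) :=
  ∑ j : Fin (k + 1), diffCoeff k j •
    mixOp p (j * τ) (node_bounds hτ hkτ j).1 (node_bounds hτ hkτ j).2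

lemma diffAlong_congr {d k : ℕ} {τ : ℝ} (hτ : 0 < τ) (hkτ : k * τ ≤ 1)
    {f g : EuclideanSpace ℝ (Fin d) → ℝ} (h : f =ᵐ[cubeMeasure d] g) :
    diffAlong k τ f =ᵐ[(cubeMeasure d).prod (cubeMeasure d)] diffAlong k τ g := by
  have : ∀ᵐ z ∂(cubeMeasure d).prod (cubeMeasure d), ∀ j : Fin (k + 1),
      f (mixMap (j * τ) z) = g (mixMap (j * τ) z) := by
    rw [Filter.eventually_all]
    exact fun j => ae_comp_mixMap (node_bounds hτ hkτ j).1 (node_bounds hτ hkτ j).2 h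
  filter_upwards [this] with z hz
  simp only [diffAlong_eq_sum, hz]

lemma coeFn_diffOp {d : ℕ} {p : ENNReal} [Fact (1 ≤ p)] {k : ℕ} {τ : ℝ} (hτ : 0 < τ)
    (hkτ : k * τ ≤ 1) (f : Lp ℝ p (cubeMeasure d)) :
    diffOp p hτ hkτ f =ᵐ[(cubeMeasure d).prod (cubeMeasure d)] diffAlong k τ f := by
  have h1 : ∀ᵐ z ∂(cubeMeasure d).prod (cubeMeasure d), ∀ j ∈ (Finset.univ : Finset (Fin (k + 1))),
      (diffCoeff k j • mixOp p (j * τ) (node_bounds hτ hkτ j).1 (node_bounds hτ hkτ j).2 f :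
        Lp ℝ p ((cubeMeasure d).prod (cubeMeasure d))) z =
      diffCoeff k j * f (mixMap (j * τ) z) := by
    rw [Filter.eventually_all_finset]
    intro j _
    filter_upwards [Lp.coeFn_smul (diffCoeff k j)
        (mixOp p (j * τ) (node_bounds hτ hkτ j).1 (node_bounds hτ hkτ j).2 f),
      coeFn_compLp (continuous_mixMap (j * τ)).measurable (mixConst_ne_top d (j * τ))
        (map_mixMap_le (node_bounds hτ hkτ j).1 (node_bounds hτ hkτ j).2) f] with z h1 h2
    rw [h1, Pi.smul_apply, smul_eq_mul, mixOp, h2, Function.comp_apply]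
  have h2 : diffOp p hτ hkτ f = ∑ j : Fin (k + 1), diffCoeff k j •
      mixOp p (j * τ) (node_bounds hτ hkτ j).1 (node_bounds hτ hkτ j).2 f := by
    simp [diffOp]
  rw [h2]
  filter_upwards [h1, Lp.coeFn_finsetSum Finset.univ fun j : Fin (k + 1) => diffCoeff k j •
      mixOp p (j * τ) (node_bounds hτ hkτ j).1 (node_bounds hτ hkτ j).2 f] with z h1 h2
  rw [h2, Finset.sum_apply, Finset.sum_congr rfl h1, diffAlong_eq_sum]

lemma norm_diffOp_toLp {d : ℕ} {p : ENNReal} [Fact (1 ≤ p)] {k : ℕ} {τ : ℝ} (hτ : 0 < τ)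
    (hkτ : k * τ ≤ 1) (f : EuclideanSpace ℝ (Fin d) → ℝ) (hf : MemLp f p (cubeMeasure d)) :
    ‖diffOp p hτ hkτ (hf.toLp f)‖ =
      (eLpNorm (diffAlong k τ f) p ((cubeMeasure d).prod (cubeMeasure d))).toReal := by
  rw [Lp.norm_def]
  exact congrArg _ (eLpNorm_congr_ae ((coeFn_diffOp hτ hkτ _).trans
    (diffAlong_congr hτ hkτ hf.coeFn_toLp)))

/-! ### The smoothing operator built from a bump function. -/

/-- The centre of the unit cube. -/
def cubeCenter (d : ℕ) : EuclideanSpace ℝ (Fin d) := WithLp.toLp 2 fun _ => 1 / 2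

/-- A smooth bump function at the centre of the unit cube. -/
def centralBump (d : ℕ) : ContDiffBump (cubeCenter d) where
  rIn := 1 / 8
  rOut := 1 / 4
  rIn_pos := by norm_num
  rIn_lt_rOut := by norm_num

/-- The central bump function with integral one. -/
def unitBump (d : ℕ) : EuclideanSpace ℝ (Fin d) → ℝ := (centralBump d).normed volume

lemma contDiff_unitBump (d : ℕ) : ContDiff ℝ (⊤ : ℕ∞) (unitBump d) :=
  (centralBump d).contDiff_normed

lemma hasCompactSupport_unitBump (d : ℕ) : HasCompactSupport (unitBump d) :=
  (centralBump d).hasCompactSupport_normed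

lemma unitBump_eq_zero {d : ℕ} {x : EuclideanSpace ℝ (Fin d)} (hx : x ∉ unitCube d) :
    unitBump d x = 0 := by
  by_contra h
  have h1 : x ∈ Function.support ((centralBump d).normed volume) := h
  rw [(centralBump d).support_normed_eq, Metric.mem_ball] at h1
  refine hx fun i => ?_
  have h2 : |x i - 1 / 2| < 1 / 4 := by
    have := (PiLp.norm_apply_le (x - cubeCenter d) i).trans_lt (dist_eq_norm x _ ▸ h1)
    simpa [cubeCenter, centralBump] using this
  rw [abs_lt] at h2
  constructor <;> linarith [h2.1, h2.2]

lemma setIntegral_unitBump (d : ℕ) : ∫ x, unitBump d x ∂cubeMeasure d = 1 := by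
  rw [setIntegral_eq_integral_of_forall_compl_eq_zero fun x hx => unitBump_eq_zero hx]
  exact (centralBump d).integral_normed

lemma exists_bound_unitBump (d : ℕ) : ∃ M, 0 ≤ M ∧ ∀ x, |unitBump d x| ≤ M := by
  obtain ⟨M, hM⟩ := (contDiff_unitBump d).continuous.bounded_above_of_compact_support
    (hasCompactSupport_unitBump d)
  exact ⟨M, (norm_nonneg _).trans (hM 0), hM⟩

/-- The rescaled and reflected bump. -/
def scaledBump (d : ℕ) (s : ℝ) (v : EuclideanSpace ℝ (Fin d)) : ℝ :=
  (s ^ d)⁻¹ * unitBump d ((-s⁻¹) • v)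

lemma contDiff_scaledBump (d : ℕ) (s : ℝ) : ContDiff ℝ (⊤ : ℕ∞) (scaledBump d s) :=
  contDiff_const.mul ((contDiff_unitBump d).comp (contDiff_const_smul _))

lemma hasCompactSupport_scaledBump (d : ℕ) {s : ℝ} (hs : s ≠ 0) :
    HasCompactSupport (scaledBump d s) :=
  ((hasCompactSupport_unitBump d).comp_smul (neg_ne_zero.2 (inv_ne_zero hs))).mul_left

/-- Substitute z = (1 - s)x + sy. Convexity puts the support of the transformed bump inside the
cube, so both integrals may be taken over the whole space. The reflection in the scaled bump gives
the right side the form of a convolution evaluated at (1 - s)x. -/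
lemma integral_unitBump_mul_mix {d : ℕ} {s : ℝ} (hs0 : 0 < s) (hs1 : s ≤ 1)
    (f : EuclideanSpace ℝ (Fin d) → ℝ) {x : EuclideanSpace ℝ (Fin d)} (hx : x ∈ unitCube d) :
    ∫ y, unitBump d y * f (mixMap s (x, y)) ∂cubeMeasure d =
      ∫ z, scaledBump d s ((1 - s) • x - z) * f z ∂cubeMeasure d := by
  have h1 : ∀ z, (-s⁻¹) • ((1 - s) • x - z) = s⁻¹ • (z - (1 - s) • x) := fun z => by module
  rw [setIntegral_eq_integral_of_forall_compl_eq_zero fun y hy => by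
      rw [unitBump_eq_zero hy, zero_mul],
    setIntegral_eq_integral_of_forall_compl_eq_zero fun z hz => ?_]
  · let H : EuclideanSpace ℝ (Fin d) → ℝ :=
      fun w => unitBump d (s⁻¹ • w) * f ((1 - s) • x + w)
    have h2 : ∀ y, unitBump d y * f (mixMap s (x, y)) = H (s • y) := fun y => by
      simp only [H, smul_smul, inv_mul_cancel₀ hs0.ne', one_smul, mixMap]
      congr 2
      module
    rw [integral_congr_ae (Filter.Eventually.of_forall h2),
      Measure.integral_comp_smul volume H s, finrank_euclideanSpace_fin,
      abs_of_pos (by positivity), ← integral_sub_right_eq_self H ((1 - s) • x), smul_eq_mul,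
      ← integral_const_mul]
    refine integral_congr_ae (Filter.Eventually.of_forall fun z => ?_)
    simp only [H, scaledBump, h1, add_sub_cancel]
    ring
  · have : unitBump d (s⁻¹ • (z - (1 - s) • x)) = 0 := by
      refine unitBump_eq_zero fun hmem => hz ?_
      rw [unitCube_eq_cubeAt] at hmem hx ⊢
      have := mix_mem_cubeAt hx hmem hs0.le hs1
      convert this using 1
      rw [smul_sub, smul_smul, mul_inv_cancel₀ hs0.ne']
      module
    rw [scaledBump, h1, this, mul_zero, zero_mul]

/-- The kernel of the smoothing operator that agrees with the identity modulo the differences. -/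
def smoothingKernel (d k : ℕ) (τ : ℝ) (x z : EuclideanSpace ℝ (Fin d)) : ℝ :=
  ∑ j : Fin k, (-(-1) ^ k * diffCoeff k (j + 1)) *
    scaledBump d ((j + 1 : ℕ) * τ) ((1 - (j + 1 : ℕ) * τ) • x - z)

lemma uniformContinuous_finsetSum {ι X : Type*} [UniformSpace X] (t : Finset ι) (F : ι → X → ℝ)
    (h : ∀ i ∈ t, UniformContinuous (F i)) : UniformContinuous fun x => ∑ i ∈ t, F i x := by
  classical
  induction t using Finset.induction_on with
  | empty => simpa using uniformContinuous_const
  | insert i t hi ih =>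
    simp only [Finset.sum_insert hi]
    exact (h i (Finset.mem_insert_self i t)).add
      (ih fun j hj => h j (Finset.mem_insert_of_mem hj))

lemma node_pos {k : ℕ} {τ : ℝ} (hτ : 0 < τ) (j : Fin k) : 0 < ((j + 1 : ℕ) : ℝ) * τ := by
  positivity

lemma node_le_one {k : ℕ} {τ : ℝ} (hτ : 0 < τ) (hkτ : k * τ ≤ 1) (j : Fin k) :
    ((j + 1 : ℕ) : ℝ) * τ ≤ 1 := by
  refine le_trans ?_ hkτ
  have : ((j + 1 : ℕ) : ℝ) ≤ k := by exact_mod_cast j.2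
  gcongr

lemma uniformContinuous_smoothingKernel (d k : ℕ) {τ : ℝ} (hτ : 0 < τ) :
    UniformContinuous (Function.uncurry (smoothingKernel d k τ)) := by
  refine uniformContinuous_finsetSum (X := EuclideanSpace ℝ (Fin d) × EuclideanSpace ℝ (Fin d))
    Finset.univ (fun (j : Fin k) z => (-(-1) ^ k * diffCoeff k (j + 1)) *
      scaledBump d ((j + 1 : ℕ) * τ) ((1 - (j + 1 : ℕ) * τ) • z.1 - z.2)) fun j _ => ?_
  have h1 : UniformContinuous (scaledBump d ((j + 1 : ℕ) * τ)) :=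
    (hasCompactSupport_scaledBump d (node_pos hτ j).ne').uniformContinuous_of_continuous
      (contDiff_scaledBump d _).continuous
  have h2 : UniformContinuous fun z : EuclideanSpace ℝ (Fin d) × EuclideanSpace ℝ (Fin d) =>
      (1 - (j + 1 : ℕ) * τ) • z.1 - z.2 :=
    ((uniformContinuous_const_smul (1 - ((j + 1 : ℕ) : ℝ) * τ)).comp uniformContinuous_fst).sub
      uniformContinuous_snd
  exact Real.uniformContinuous_const_mul.comp (h1.comp h2)

lemma exists_bound_smoothingKernel (d k : ℕ) {τ : ℝ} (hτ : 0 < τ) :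
    ∃ M, 0 ≤ M ∧ ∀ x z, |smoothingKernel d k τ x z| ≤ M := by
  have h : ∀ j : Fin k, ∃ M, 0 ≤ M ∧ ∀ v, |scaledBump d ((j + 1 : ℕ) * τ) v| ≤ M := fun j => by
    obtain ⟨M, hM⟩ := (contDiff_scaledBump d ((j + 1 : ℕ) * τ)).continuous
      |>.bounded_above_of_compact_support (hasCompactSupport_scaledBump d (node_pos hτ j).ne')
    exact ⟨M, (norm_nonneg _).trans (hM 0), hM⟩
  choose M hM0 hM using h
  refine ⟨∑ j : Fin k, |-(-1) ^ k * diffCoeff k (j + 1)| * M j,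
    Finset.sum_nonneg fun j _ => mul_nonneg (abs_nonneg _) (hM0 j), fun x z => ?_⟩
  refine (Finset.abs_sum_le_sum_abs _ _).trans (Finset.sum_le_sum fun j _ => ?_)
  rw [abs_mul]
  exact mul_le_mul_of_nonneg_left (hM j _) (abs_nonneg _)

/-- A bounded set can be mapped into a finite set by a simple function that moves its points only
a little. -/
lemma exists_simpleFunc_dist_lt {X : Type*} [MetricSpace X] [MeasurableSpace X]
    [OpensMeasurableSpace X] [Nonempty X] {K : Set X} (hK : TotallyBounded K) {δ : ℝ}
    (hδ : 0 < δ) : ∃ s : SimpleFunc X X, ∀ x ∈ K, dist (s x) x < δ := by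
  obtain ⟨t, -, htf, htK⟩ := Metric.finite_approx_of_totallyBounded hK δ hδ
  rcases t.eq_empty_or_nonempty with rfl | hne
  · refine ⟨SimpleFunc.const X (Classical.arbitrary X), fun x hx => ?_⟩
    simpa using htK hx
  · obtain ⟨e, he⟩ := htf.countable.exists_eq_range hne
    have h1 : ∀ y ∈ t, ∃ n, e n = y := fun y hy => by rw [he] at hy; exact hy
    choose! idx hidx using h1
    -- The cutoff is the largest index of a point of the net, so the nearest-point search covers the
    -- whole net.
    refine ⟨SimpleFunc.nearestPt e (htf.toFinset.sup idx), fun x hx => ?_⟩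
    obtain ⟨y, hy, hxy⟩ := Set.mem_iUnion₂.1 (htK hx)
    have h2 := SimpleFunc.edist_nearestPt_le e x
      (Finset.le_sup (f := idx) (htf.mem_toFinset.2 hy))
    rw [hidx y hy, edist_dist, edist_dist, ENNReal.ofReal_le_ofReal_iff dist_nonneg] at h2
    rw [Metric.mem_ball, dist_comm] at hxy
    exact h2.trans_lt hxy

lemma mem_closedBall_of_mem_unitCube {d : ℕ} {x : EuclideanSpace ℝ (Fin d)}
    (hx : x ∈ unitCube d) : x ∈ Metric.closedBall (0 : EuclideanSpace ℝ (Fin d)) d := by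
  have h0 : (0 : EuclideanSpace ℝ (Fin d)) ∈ cubeAt 0 1 := fun i => by simp
  rw [unitCube_eq_cubeAt] at hx
  simpa using norm_sub_le_of_mem_cubeAt h0 hx zero_le_one

lemma totallyBounded_unitCube (d : ℕ) : TotallyBounded (unitCube d) :=
  (isCompact_closedBall (0 : EuclideanSpace ℝ (Fin d)) d).totallyBounded.subset
    fun _ => mem_closedBall_of_mem_unitCube

/-- Averaging the differences recovers the function up to the smoothing operator. -/
lemma ae_sub_smoothing_eq {d k : ℕ} {τ : ℝ} (hτ : 0 < τ) (hkτ : k * τ ≤ 1)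
    {f : EuclideanSpace ℝ (Fin d) → ℝ} (hf : Integrable f (cubeMeasure d)) :
    ∀ᵐ x ∂cubeMeasure d, f x - ∫ z, smoothingKernel d k τ x z * f z ∂cubeMeasure d =
      (-1) ^ k * ∫ y, unitBump d y * diffAlong k τ f (x, y) ∂cubeMeasure d := by
  obtain ⟨M, -, hM⟩ := exists_bound_unitBump d
  have hint : ∀ᵐ x ∂cubeMeasure d, ∀ j : Fin (k + 1),
      Integrable (fun y => f (mixMap (j * τ) (x, y))) (cubeMeasure d) := by
    rw [Filter.eventually_all]
    intro j
    have h1 : MemLp (f ∘ mixMap (j * τ)) 1 ((cubeMeasure d).prod (cubeMeasure d)) :=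
      ((memLp_one_iff_integrable.2 hf).of_measure_le_smul (mixConst_ne_top d _)
        (map_mixMap_le (node_bounds hτ hkτ j).1 (node_bounds hτ hkτ j).2)).comp_of_map
        (continuous_mixMap _).aemeasurable
    exact (memLp_one_iff_integrable.1 h1).prod_right_ae
  filter_upwards [hint, ae_restrict_mem (measurableSet_unitCube d)] with x hx hxQ
  have hx' : ∀ j : Fin (k + 1), Integrable
      (fun y => unitBump d y * f (mixMap (j * τ) (x, y))) (cubeMeasure d) := fun j =>
    (hx j).bdd_mul (c := M) (contDiff_unitBump d).continuous.aestronglyMeasurable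
      (Filter.Eventually.of_forall hM)
  have h2 : ∫ y, unitBump d y * diffAlong k τ f (x, y) ∂cubeMeasure d =
      ∑ j : Fin (k + 1), diffCoeff k j *
        ∫ y, unitBump d y * f (mixMap (j * τ) (x, y)) ∂cubeMeasure d := by
    simp_rw [← integral_const_mul]
    rw [← integral_finsetSum _ fun j _ => (hx' j).const_mul _]
    refine integral_congr_ae (Filter.Eventually.of_forall fun y => ?_)
    simp only [diffAlong_eq_sum, Finset.mul_sum]
    exact Finset.sum_congr rfl fun j _ => by ring
  have h3 : ∫ z, smoothingKernel d k τ x z * f z ∂cubeMeasure d =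
      ∑ j : Fin k, (-(-1) ^ k * diffCoeff k (j + 1)) *
        ∫ y, unitBump d y * f (mixMap ((j + 1 : ℕ) * τ) (x, y)) ∂cubeMeasure d := by
    simp_rw [fun j : Fin k => integral_unitBump_mul_mix (node_pos hτ j) (node_le_one hτ hkτ j) f hxQ,
      ← integral_const_mul]
    rw [← integral_finsetSum]
    · refine integral_congr_ae (Filter.Eventually.of_forall fun z => ?_)
      simp only [smoothingKernel, Finset.sum_mul]
      exact Finset.sum_congr rfl fun j _ => by ring
    · intro j _
      refine Integrable.const_mul ?_ _
      obtain ⟨M', hM'⟩ := (contDiff_scaledBump d ((j + 1 : ℕ) * τ)).continuous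
        |>.bounded_above_of_compact_support (hasCompactSupport_scaledBump d (node_pos hτ j).ne')
      exact hf.bdd_mul (c := M') ((contDiff_scaledBump d _).continuous.comp
        (by fun_prop)).aestronglyMeasurable (Filter.Eventually.of_forall fun z => hM' _)
  -- The node j = 0 does not depend on y, and the bump has integral one. This term isolates f(x);
  -- the other nodes make up the smoothing operator.
  have h4 : ∫ y, unitBump d y * f (mixMap (0 * τ) (x, y)) ∂cubeMeasure d = f x := by
    simp only [mixMap, zero_mul, zero_smul, add_zero]
    rw [integral_mul_const, setIntegral_unitBump, one_mul]
  have h5 : ((-1 : ℝ) ^ k) * (-1) ^ k = 1 := by rw [← mul_pow]; norm_num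
  rw [h2, h3, Fin.sum_univ_succ]
  simp only [Fin.val_zero, Nat.cast_zero, h4, Fin.val_succ, diffCoeff, Nat.sub_zero,
    Nat.choose_zero_right, Nat.cast_one, mul_one]
  rw [mul_add, ← mul_assoc, h5, one_mul, sub_eq_add_neg, ← Finset.sum_neg_distrib, Finset.mul_sum]
  congr 1
  exact Finset.sum_congr rfl fun j _ => by ring

/-! ### The kernel of the difference operator. -/

/-- The open unit cube. -/
def openCube (d : ℕ) : Set (EuclideanSpace ℝ (Fin d)) := {x | ∀ i, x i ∈ Set.Ioo (0 : ℝ) 1}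

lemma isOpen_openCube (d : ℕ) : IsOpen (openCube d) := by
  have : openCube d = ⋂ i, ((fun x : EuclideanSpace ℝ (Fin d) => x i) ⁻¹' Set.Ioo (0 : ℝ) 1) := by
    ext x; simp [openCube]
  rw [this]
  exact isOpen_iInter_of_finite fun i => isOpen_Ioo.preimage (by fun_prop)

lemma openCube_subset_unitCube (d : ℕ) : openCube d ⊆ unitCube d :=
  fun _ hx i => ⟨(hx i).1.le, (hx i).2⟩

lemma starConvex_openCube (d : ℕ) : StarConvex ℝ (cubeCenter d) (openCube d) := by
  have hc : Convex ℝ (openCube d) := by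
    intro x hx y hy a b ha hb hab i
    have := convex_Ioo (0 : ℝ) 1 (hx i) (hy i) ha hb hab
    simpa using this
  exact hc.starConvex fun i => by simp [cubeCenter]; norm_num

lemma openCube_ae_eq (d : ℕ) : openCube d =ᵐ[volume] unitCube d := by
  have h := (EuclideanSpace.volume_preserving_symm_measurableEquiv_toLp (Fin d))
  have h2 : openCube d = (MeasurableEquiv.toLp 2 (Fin d → ℝ)).symm ⁻¹'
      (Set.univ.pi fun _ => Set.Ioo (0 : ℝ) 1) := by
    ext x; simp [openCube]
  have h3 : volume (openCube d) = 1 := by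
    rw [h2, h.measure_preimage_equiv, Real.volume_pi_Ioo]
    simp
  refine ae_eq_of_subset_of_measure_ge (openCube_subset_unitCube d) ?_
    (isOpen_openCube d).measurableSet.nullMeasurableSet ?_
  · rw [h3, volume_unitCube]
  · rw [volume_unitCube]; exact ENNReal.one_ne_top

/-- Each term is a convolution of an integrable function with a smooth compactly supported one,
composed with a dilation. -/
lemma contDiff_smoothing {d k : ℕ} {τ : ℝ} (hτ : 0 < τ)
    {f : EuclideanSpace ℝ (Fin d) → ℝ} (hf : Integrable f (cubeMeasure d)) :
    ContDiff ℝ (⊤ : ℕ∞) fun x => ∫ z, smoothingKernel d k τ x z * f z ∂cubeMeasure d := by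
  let u : EuclideanSpace ℝ (Fin d) → ℝ := (unitCube d).indicator f
  have hu : Integrable u := (integrable_indicator_iff (measurableSet_unitCube d)).2 hf
  have h1 : ∀ j : Fin k, ContDiff ℝ (⊤ : ℕ∞) fun w =>
      ∫ z, scaledBump d ((j + 1 : ℕ) * τ) (w - z) * f z ∂cubeMeasure d := fun j => by
    have := (hasCompactSupport_scaledBump d (node_pos hτ j).ne').contDiff_convolution_right
      (ContinuousLinearMap.mul ℝ ℝ) (hu.locallyIntegrable) (contDiff_scaledBump d _)
      (μ := volume)
    convert this using 1
    funext w
    rw [convolution_def, ← integral_indicator (measurableSet_unitCube d)]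
    refine integral_congr_ae (Filter.Eventually.of_forall fun z => ?_)
    by_cases hz : z ∈ unitCube d
    · simp [u, hz, mul_comm]
    · simp [u, hz]
  have h2 : (fun x => ∫ z, smoothingKernel d k τ x z * f z ∂cubeMeasure d) = fun x =>
      ∑ j : Fin k, (-(-1) ^ k * diffCoeff k (j + 1)) * ∫ z, scaledBump d ((j + 1 : ℕ) * τ)
        ((1 - (j + 1 : ℕ) * τ) • x - z) * f z ∂cubeMeasure d := by
    funext x
    simp_rw [← integral_const_mul]
    rw [← integral_finsetSum]
    · refine integral_congr_ae (Filter.Eventually.of_forall fun z => ?_)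
      simp only [smoothingKernel, Finset.sum_mul]
      exact Finset.sum_congr rfl fun j _ => by ring
    · intro j _
      refine Integrable.const_mul ?_ _
      obtain ⟨M', hM'⟩ := (contDiff_scaledBump d ((j + 1 : ℕ) * τ)).continuous
        |>.bounded_above_of_compact_support (hasCompactSupport_scaledBump d (node_pos hτ j).ne')
      exact hf.bdd_mul (c := M') ((contDiff_scaledBump d _).continuous.comp
        (by fun_prop)).aestronglyMeasurable (Filter.Eventually.of_forall fun z => hM' _)
  rw [h2]
  exact ContDiff.sum fun j _ => contDiff_const.mul ((h1 j).comp (contDiff_const_smul _))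

lemma continuous_diffAlong {d : ℕ} (k : ℕ) (τ : ℝ) {g : EuclideanSpace ℝ (Fin d) → ℝ}
    (hg : Continuous g) : Continuous (diffAlong k τ g) := by
  have : diffAlong k τ g = fun z => ∑ j : Fin (k + 1), diffCoeff k j * g (mixMap (j * τ) z) :=
    funext fun z => diffAlong_eq_sum k τ g z
  rw [this]
  exact continuous_finsetSum _ fun j _ => continuous_const.mul (hg.comp (continuous_mixMap _))

/-- Functions with vanishing `k`-th differences are polynomials of degree less than `k`. -/
lemma exists_polyFun_of_diffAlong_eq_zero {d k : ℕ} (hk : 1 ≤ k) {τ : ℝ} (hτ : 0 < τ)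
    (hkτ : k * τ ≤ 1) {f : EuclideanSpace ℝ (Fin d) → ℝ} (hf : Integrable f (cubeMeasure d))
    (h : diffAlong k τ f =ᵐ[(cubeMeasure d).prod (cubeMeasure d)] 0) :
    ∃ P ∈ polyFun d (k - 1), f =ᵐ[cubeMeasure d] P := by
  set g := fun x => ∫ z, smoothingKernel d k τ x z * f z ∂cubeMeasure d with hgdef
  have hg : ContDiff ℝ (⊤ : ℕ∞) g := contDiff_smoothing hτ hf
  -- When the differences vanish, the averaging identity says that f agrees with its smoothing.
  have hfg : f =ᵐ[cubeMeasure d] g := by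
    filter_upwards [ae_sub_smoothing_eq hτ hkτ hf, Measure.ae_ae_of_ae_prod h] with x hx1 hx2
    have : ∫ y, unitBump d y * diffAlong k τ f (x, y) ∂cubeMeasure d = 0 := by
      refine integral_eq_zero_of_ae ?_
      filter_upwards [hx2] with y hy
      rw [hy]; simp
    rw [this, mul_zero, sub_eq_zero] at hx1
    exact hx1
  have hUopen := (isOpen_openCube d).prod (isOpen_openCube d)
  -- Continuity upgrades vanishing almost everywhere to vanishing at every pair of points of the
  -- open cube.
  have hDg : Set.EqOn (diffAlong k τ g) 0 (openCube d ×ˢ openCube d) := by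
    have h1 : diffAlong k τ g =ᵐ[(cubeMeasure d).prod (cubeMeasure d)] 0 :=
      (diffAlong_congr hτ hkτ hfg).symm.trans h
    rw [Measure.prod_restrict] at h1
    exact Measure.eqOn_open_of_ae_eq (ae_restrict_of_ae_restrict_of_subset
        (Set.prod_mono (openCube_subset_unitCube d) (openCube_subset_unitCube d)) h1) hUopen
      (continuous_diffAlong k τ hg.continuous).continuousOn continuousOn_const
  obtain ⟨P, hP, hgP⟩ := exists_polyFun_of_fwdDiff_eq_zero hk hg (starConvex_openCube d)
    fun x hx v => by
      -- The second point is x + (s/τ)v, so that the step τ(y - x) of the averaged difference is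
      -- exactly sv.
      have hcont : Continuous fun s : ℝ => x + (s / τ) • v := by fun_prop
      have hmem : ∀ᶠ s in nhds (0 : ℝ), x + (s / τ) • v ∈ openCube d :=
        hcont.continuousAt.eventually_mem ((isOpen_openCube d).mem_nhds (by simpa using hx))
      filter_upwards [hmem] with s hs
      have := hDg (Set.mk_mem_prod hx hs)
      rw [diffAlong] at this
      simpa [smul_smul, mul_div_cancel₀ _ hτ.ne'] using this
  refine ⟨P, hP, hfg.trans ?_⟩
  have : g =ᵐ[volume.restrict (openCube d)] P := by
    filter_upwards [ae_restrict_mem (isOpen_openCube d).measurableSet] with x hx using hgP x hx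
  rwa [Measure.restrict_congr_set (openCube_ae_eq d)] at this

/-! ### Whitney's inequality. -/

/-- On a probability space the L_1 norm is at most the L_p norm. Apply this in y for almost every x,
then integrate in x. -/
lemma eLpNorm_le_of_le_lintegral {α : Type*} [MeasurableSpace α] {μ : Measure α}
    [IsProbabilityMeasure μ] {p : ENNReal} (hp : 1 ≤ p) (hp' : p ≠ ⊤) {h : α → ℝ}
    {w : α × α → ℝ} (hw : AEStronglyMeasurable w (μ.prod μ)) {C : ENNReal} (hC : C ≠ ⊤)
    (hle : ∀ᵐ x ∂μ, ‖h x‖ₑ ≤ C * ∫⁻ y, ‖w (x, y)‖ₑ ∂μ) :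
    eLpNorm h p μ ≤ C * eLpNorm w p (μ.prod μ) := by
  have hp0 : p ≠ 0 := (zero_lt_one.trans_le hp).ne'
  have hpr : 0 < p.toReal := ENNReal.toReal_pos hp0 hp'
  rw [eLpNorm_eq_lintegral_rpow_enorm_toReal hp0 hp', eLpNorm_eq_lintegral_rpow_enorm_toReal hp0 hp']
  have key : ∫⁻ x, ‖h x‖ₑ ^ p.toReal ∂μ ≤
      C ^ p.toReal * ∫⁻ z, ‖w z‖ₑ ^ p.toReal ∂μ.prod μ := by
    rw [lintegral_prod _ (hw.enorm.pow_const _),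
      ← lintegral_const_mul' _ _ (ENNReal.rpow_ne_top_of_nonneg hpr.le hC)]
    refine lintegral_mono_ae ?_
    filter_upwards [hle, hw.prodMk_left] with x hx hxw
    have h1 : (∫⁻ y, ‖w (x, y)‖ₑ ∂μ) ^ p.toReal ≤ ∫⁻ y, ‖w (x, y)‖ₑ ^ p.toReal ∂μ := by
      have := eLpNorm_le_eLpNorm_of_exponent_le hp hxw
      rw [eLpNorm_one_eq_lintegral_enorm, eLpNorm_eq_lintegral_rpow_enorm_toReal hp0 hp',
        one_div, ENNReal.le_rpow_inv_iff hpr] at this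
      exact this
    calc ‖h x‖ₑ ^ p.toReal ≤ (C * ∫⁻ y, ‖w (x, y)‖ₑ ∂μ) ^ p.toReal := by gcongr
      _ = C ^ p.toReal * (∫⁻ y, ‖w (x, y)‖ₑ ∂μ) ^ p.toReal := ENNReal.mul_rpow_of_nonneg _ _ hpr.le
      _ ≤ _ := by gcongr
  calc (∫⁻ x, ‖h x‖ₑ ^ p.toReal ∂μ) ^ (1 / p.toReal)
      ≤ (C ^ p.toReal * ∫⁻ z, ‖w z‖ₑ ^ p.toReal ∂μ.prod μ) ^ (1 / p.toReal) := by gcongr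
    _ = _ := by
      rw [ENNReal.mul_rpow_of_nonneg _ _ (by positivity), ← ENNReal.rpow_mul,
        mul_one_div_cancel hpr.ne', ENNReal.rpow_one]

/-- The function minus its smoothing is, up to sign, the average of the differences against the
bump. The kernel is split in two so that one part can be taken of finite rank and the other small.
-/
lemma norm_sub_kernelOp_add_le {d k : ℕ} {τ : ℝ} (hτ : 0 < τ) (hkτ : k * τ ≤ 1) {p : ENNReal}
    [Fact (1 ≤ p)] (hp' : p ≠ ⊤) {κ₁ κ₂ : EuclideanSpace ℝ (Fin d) → EuclideanSpace ℝ (Fin d) → ℝ}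
    (h₁ : Measurable (Function.uncurry κ₁)) (h₂ : Measurable (Function.uncurry κ₂)) {M₁ M₂ B : ℝ}
    (h₁0 : 0 ≤ M₁) (h₂0 : 0 ≤ M₂) (hM₁ : ∀ᵐ x ∂cubeMeasure d, ∀ z, |κ₁ x z| ≤ M₁)
    (hM₂ : ∀ᵐ x ∂cubeMeasure d, ∀ z, |κ₂ x z| ≤ M₂)
    (hsum : ∀ x z, κ₁ x z + κ₂ x z = smoothingKernel d k τ x z) (hB0 : 0 ≤ B)
    (hB : ∀ x, |unitBump d x| ≤ B) (f : Lp ℝ p (cubeMeasure d)) :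
    ‖f - (kernelOp κ₁ h₁ M₁ h₁0 hM₁ f + kernelOp κ₂ h₂ M₂ h₂0 hM₂ f)‖ ≤
      B * ‖diffOp p hτ hkτ f‖ := by
  set f₁ := kernelOp κ₁ h₁ M₁ h₁0 hM₁ f with hf₁
  set f₂ := kernelOp κ₂ h₂ M₂ h₂0 hM₂ f with hf₂
  have hf₁' := coeFn_kernelOp h₁ h₁0 hM₁ f
  have hf₂' := coeFn_kernelOp h₂ h₂0 hM₂ f
  rw [← hf₁] at hf₁'
  rw [← hf₂] at hf₂'
  clear_value f₁ f₂
  rw [Lp.norm_def, Lp.norm_def, ← ENNReal.toReal_ofReal hB0, ← ENNReal.toReal_mul]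
  refine ENNReal.toReal_mono (ENNReal.mul_ne_top ENNReal.ofReal_ne_top (Lp.eLpNorm_ne_top _)) ?_
  refine eLpNorm_le_of_le_lintegral Fact.out hp' (Lp.aestronglyMeasurable _)
    ENNReal.ofReal_ne_top ?_
  filter_upwards [Lp.coeFn_sub f (f₁ + f₂), Lp.coeFn_add f₁ f₂, hf₁', hf₂', hM₁, hM₂,
    ae_sub_smoothing_eq hτ hkτ (integrable_Lp f),
    Measure.ae_ae_of_ae_prod (coeFn_diffOp hτ hkτ f)] with x h1 h2 h3 h4 h5' h5 h6 h7
  have h8 : (f - (f₁ + f₂) : Lp ℝ p (cubeMeasure d)) x =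
      (-1) ^ k * ∫ y, unitBump d y * diffAlong k τ f (x, y) ∂cubeMeasure d := by
    rw [h1, Pi.sub_apply, h2, Pi.add_apply, h3, h4, ← h6, ← integral_add
      (integrable_kernel_mul h₁ h5' f) (integrable_kernel_mul h₂ h5 f)]
    congr 2
    funext z
    rw [← hsum]
    ring
  rw [h8, enorm_mul, enorm_pow]
  simp only [enorm_neg, enorm_one, one_pow, one_mul]
  refine (enorm_integral_le_lintegral_enorm _).trans ?_
  rw [← lintegral_const_mul' _ _ ENNReal.ofReal_ne_top]
  refine lintegral_mono_ae ?_
  filter_upwards [h7] with y hy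
  rw [hy, enorm_mul]
  gcongr
  rw [← ofReal_norm]
  exact ENNReal.ofReal_le_ofReal (hB y)

/-- Every function is close to the kernel of the difference operator. -/
lemma exists_near_kernel_diffOp (d : ℕ) {k : ℕ} {τ : ℝ} (hτ : 0 < τ)
    (hkτ : k * τ ≤ 1) {p : ENNReal} [Fact (1 ≤ p)] (hp' : p ≠ ⊤) :
    ∃ C : ℝ, ∀ f : Lp ℝ p (cubeMeasure d), ∃ u, diffOp p hτ hkτ u = 0 ∧
      ‖f - u‖ ≤ C * ‖diffOp p hτ hkτ f‖ := by
  have hUC := uniformContinuous_smoothingKernel d k hτ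
  obtain ⟨M, hM0, hM⟩ := exists_bound_smoothingKernel d k hτ
  obtain ⟨B, hB0, hB⟩ := exists_bound_unitBump d
  have key := fun κ₁ κ₂ h₁ h₂ M₁ M₂ h₁0 h₂0 hM₁ hM₂ hsum => norm_sub_kernelOp_add_le (d := d)
    (k := k) (p := p) hτ hkτ hp' (κ₁ := κ₁) (κ₂ := κ₂) h₁ h₂ (M₁ := M₁) (M₂ := M₂) h₁0 h₂0 hM₁ hM₂
    hsum hB0 hB
  generalize smoothingKernel d k τ = κ at hUC hM key
  have hmeas : Measurable (Function.uncurry κ) := hUC.continuous.measurable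
  -- Rounding x to a finite δ-net changes the kernel by less than 1/2. The rounded kernel has finite
  -- rank and the remainder has norm at most 1/2.
  obtain ⟨δ, hδ, hδκ⟩ := Metric.uniformContinuous_iff.1 hUC (1 / 2) (by norm_num)
  obtain ⟨s, hs⟩ := exists_simpleFunc_dist_lt (totallyBounded_unitCube d) hδ
  have hsmeas : Measurable (Function.uncurry fun x z => κ (s x) z) :=
    hmeas.comp ((s.measurable.comp measurable_fst).prodMk measurable_snd)
  have hF : ∀ᵐ x ∂cubeMeasure d, ∀ z, |κ (s x) z| ≤ M :=
    Filter.Eventually.of_forall fun x z => hM _ _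
  have hRmeas : Measurable (Function.uncurry fun x z => κ x z - κ (s x) z) := hmeas.sub hsmeas
  have hR : ∀ᵐ x ∂cubeMeasure d, ∀ z, |κ x z - κ (s x) z| ≤ 1 / 2 := by
    filter_upwards [ae_restrict_mem (measurableSet_unitCube d)] with x hx z
    have h1 : dist (x, z) (s x, z) < δ := by
      rw [Prod.dist_eq, dist_self, max_eq_left dist_nonneg, dist_comm]
      exact hs x hx
    exact (hδκ h1).le
  have hR1 := norm_kernelOp_le (p := p) hRmeas one_half_pos.le hR
  exact exists_near_kernel (diffOp (d := d) p hτ hkτ)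
    (kernelOp (fun x z => κ (s x) z) hsmeas M hM0 hF)
    (kernelOp (fun x z => κ x z - κ (s x) z) hRmeas (1 / 2) one_half_pos.le hR)
    (finiteDimensional_range_kernelOp κ s hsmeas M hM0 hF)
    (hR1.trans_lt one_half_lt_one) B
    (key _ _ hsmeas hRmeas M (1 / 2) hM0 one_half_pos.le hF hR (fun x z => by ring))

/-- Whitney's inequality with averaged differences on the unit cube. -/
theorem exists_whitney_unitCube (d : ℕ) {k : ℕ} (hk : 1 ≤ k) {τ : ℝ} (hτ : 0 < τ)
    (hkτ : k * τ ≤ 1) {p : ENNReal} (hp : 1 ≤ p) (hp' : p ≠ ⊤) :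
    ∃ C : ENNReal, C ≠ ⊤ ∧ ∀ f : EuclideanSpace ℝ (Fin d) → ℝ, MemLp f p (cubeMeasure d) →
      ∃ P ∈ polyFun d (k - 1), eLpNorm (f - P) p (cubeMeasure d) ≤
        C * eLpNorm (diffAlong k τ f) p ((cubeMeasure d).prod (cubeMeasure d)) := by
  have : Fact (1 ≤ p) := ⟨hp⟩
  obtain ⟨C, hC⟩ := exists_near_kernel_diffOp d hτ hkτ hp'
  refine ⟨ENNReal.ofReal (max C 0), ENNReal.ofReal_ne_top, fun f hf => ?_⟩
  obtain ⟨u, hu0, hu⟩ := hC (hf.toLp f)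
  obtain ⟨P, hP, huP⟩ := exists_polyFun_of_diffAlong_eq_zero hk hτ hkτ (integrable_Lp u) (by
    have h1 := coeFn_diffOp hτ hkτ u
    rw [hu0] at h1
    exact h1.symm.trans (Lp.coeFn_zero _ _ _))
  refine ⟨P, hP, ?_⟩
  have h1 : eLpNorm (f - P) p (cubeMeasure d) = 
      eLpNorm (hf.toLp f - u : Lp ℝ p (cubeMeasure d)) p (cubeMeasure d) := by
    refine eLpNorm_congr_ae ?_
    filter_upwards [hf.coeFn_toLp, huP, Lp.coeFn_sub (hf.toLp f) u] with x h1 h2 h3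
    rw [h3, Pi.sub_apply, Pi.sub_apply, h1, h2]
  have h2 : eLpNorm (diffAlong k τ f) p ((cubeMeasure d).prod (cubeMeasure d)) ≠ ⊤ := by
    rw [← eLpNorm_congr_ae ((coeFn_diffOp hτ hkτ (hf.toLp f)).trans
      (diffAlong_congr hτ hkτ hf.coeFn_toLp))]
    exact Lp.eLpNorm_ne_top _
  rw [h1, ← ENNReal.ofReal_toReal (Lp.eLpNorm_ne_top _), ← Lp.norm_def, ← ENNReal.ofReal_toReal h2,
    ← norm_diffOp_toLp hτ hkτ f hf, ← ENNReal.ofReal_mul (le_max_right _ _)]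
  exact ENNReal.ofReal_le_ofReal
    (hu.trans (mul_le_mul_of_nonneg_right (le_max_left _ _) (norm_nonneg _)))

lemma eLpNorm_rpow_eq_lintegral {α : Type*} [MeasurableSpace α] {μ : Measure α} {p : ℝ}
    (hp : 0 < p) (g : α → ℝ) :
    eLpNorm g (ENNReal.ofReal p) μ ^ p = ∫⁻ x, ‖g x‖ₑ ^ p ∂μ := by
  rw [eLpNorm_eq_lintegral_rpow_enorm_toReal (by simpa using hp) ENNReal.ofReal_ne_top,
    ENNReal.toReal_ofReal hp.le, ← ENNReal.rpow_mul, one_div_mul_cancel hp.ne', ENNReal.rpow_one]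

lemma diffAlong_comp_affine {d : ℕ} (k : ℕ) (τ : ℝ) (f : EuclideanSpace ℝ (Fin d) → ℝ)
    (a : EuclideanSpace ℝ (Fin d)) (r : ℝ) (x y : EuclideanSpace ℝ (Fin d)) :
    diffAlong k τ (fun x => f (a + r • x)) (x, y) = diffAlong k τ f (a + r • x, a + r • y) := by
  simp only [diffAlong_eq_sum, mixMap]
  refine Finset.sum_congr rfl fun j _ => ?_
  congr 2
  module

/-- Whitney's inequality with averaged differences on cubes of arbitrary size. -/
theorem exists_whitney_cubeAt (d : ℕ) {k : ℕ} (hk : 1 ≤ k) {τ : ℝ} (hτ : 0 < τ)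
    (hkτ : k * τ ≤ 1) {p : ℝ} (hp : 1 ≤ p) :
    ∃ C : ENNReal, C ≠ ⊤ ∧ ∀ f : EuclideanSpace ℝ (Fin d) → ℝ, Measurable f →
      ∀ (a : EuclideanSpace ℝ (Fin d)) (r : ℝ), 0 < r →
      ∫⁻ x in cubeAt a r, ‖f x‖ₑ ^ p ≠ ⊤ →
      ∃ P ∈ polyFun d (k - 1), ∫⁻ x in cubeAt a r, ‖f x - P x‖ₑ ^ p ≤
        C * (ENNReal.ofReal ((r ^ d)⁻¹) *
          ∫⁻ x in cubeAt a r, ∫⁻ y in cubeAt a r, ‖diffAlong k τ f (x, y)‖ₑ ^ p) := by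
  have hp0 : 0 < p := zero_lt_one.trans_le hp
  have hp1 : 1 ≤ ENNReal.ofReal p := by simpa using hp
  obtain ⟨C, hC, h⟩ := exists_whitney_unitCube d hk hτ hkτ hp1 ENNReal.ofReal_ne_top
  refine ⟨C ^ p, ENNReal.rpow_ne_top_of_nonneg hp0.le hC, fun f hf a r hr hfin => ?_⟩
  have hrd : ENNReal.ofReal ((r ^ d)⁻¹) ≠ 0 := by
    simpa using pow_pos hr d
  have hf' : Measurable fun x => f (a + r • x) := hf.comp (by fun_prop)
  have hmem : MemLp (fun x => f (a + r • x)) (ENNReal.ofReal p) (cubeMeasure d) := by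
    refine ⟨hf'.aestronglyMeasurable, ?_⟩
    rw [← ENNReal.rpow_lt_top_iff_of_pos hp0, eLpNorm_rpow_eq_lintegral hp0,
      setLIntegral_affine (fun x => ‖f x‖ₑ ^ p) a hr]
    exact ENNReal.mul_lt_top ENNReal.ofReal_lt_top hfin.lt_top
  obtain ⟨P, hP, hle⟩ := h _ hmem
  refine ⟨fun x => P (-r⁻¹ • a + r⁻¹ • x), polyFun_comp_affine hP _ _, ?_⟩
  have hle' := ENNReal.rpow_le_rpow hle hp0.le
  have hD : Measurable fun z => ‖diffAlong k τ (fun x => f (a + r • x)) z‖ₑ ^ p := by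
    have h1 : diffAlong k τ (fun x => f (a + r • x)) = fun z => ∑ j : Fin (k + 1),
        diffCoeff k j * (fun x => f (a + r • x)) (mixMap (j * τ) z) :=
      funext fun z => diffAlong_eq_sum _ _ _ _
    have h2 : Measurable (diffAlong k τ (fun x => f (a + r • x))) := by
      rw [h1]
      exact Finset.measurable_fun_sum _ fun j _ =>
        (hf'.comp (continuous_mixMap _).measurable).const_mul _
    exact h2.enorm.pow_const _
  rw [ENNReal.mul_rpow_of_nonneg _ _ hp0.le, eLpNorm_rpow_eq_lintegral hp0,
    eLpNorm_rpow_eq_lintegral hp0, lintegral_prod _ hD.aemeasurable] at hle'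
  simp only [diffAlong_comp_affine] at hle'
  have h1 : ∀ x : EuclideanSpace ℝ (Fin d), P x = P (-r⁻¹ • a + r⁻¹ • (a + r • x)) := fun x => by
    congr 1
    rw [smul_add, smul_smul, inv_mul_cancel₀ hr.ne']
    module
  have h2 : ∫⁻ x, ‖((fun x => f (a + r • x)) - P) x‖ₑ ^ p ∂cubeMeasure d =
      ENNReal.ofReal ((r ^ d)⁻¹) *
        ∫⁻ x in cubeAt a r, ‖f x - P (-r⁻¹ • a + r⁻¹ • x)‖ₑ ^ p := by
    rw [← setLIntegral_affine (fun x => ‖f x - P (-r⁻¹ • a + r⁻¹ • x)‖ₑ ^ p) a hr]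
    refine lintegral_congr fun x => ?_
    rw [Pi.sub_apply, h1 x]
  -- Both variables are rescaled here, so r^(-d) appears twice; one factor cancels against the
  -- left-hand side.
  have h3 : ∫⁻ x, ∫⁻ y, ‖diffAlong k τ f (a + r • x, a + r • y)‖ₑ ^ p ∂cubeMeasure d
      ∂cubeMeasure d = ENNReal.ofReal ((r ^ d)⁻¹) * (ENNReal.ofReal ((r ^ d)⁻¹) *
        ∫⁻ x in cubeAt a r, ∫⁻ y in cubeAt a r, ‖diffAlong k τ f (x, y)‖ₑ ^ p) := by
    have h4 : ∀ x, ∫⁻ y, ‖diffAlong k τ f (a + r • x, a + r • y)‖ₑ ^ p ∂cubeMeasure d =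
        ENNReal.ofReal ((r ^ d)⁻¹) *
          ∫⁻ y in cubeAt a r, ‖diffAlong k τ f (a + r • x, y)‖ₑ ^ p := fun x =>
      setLIntegral_affine (fun y => ‖diffAlong k τ f (a + r • x, y)‖ₑ ^ p) a hr
    simp_rw [h4]
    rw [lintegral_const_mul' _ _ ENNReal.ofReal_ne_top, setLIntegral_affine
      (fun x => ∫⁻ y in cubeAt a r, ‖diffAlong k τ f (x, y)‖ₑ ^ p) a hr]
  rw [h2, h3, mul_left_comm] at hle'
  exact (ENNReal.mul_le_mul_iff_right hrd ENNReal.ofReal_ne_top).1 hle'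

/-! ### Nikolskii's inequality for polynomials. -/

lemma memLp_of_mem_polyFun {d l : ℕ} (p : ENNReal) {P : EuclideanSpace ℝ (Fin d) → ℝ}
    (hP : P ∈ polyFun d l) : MemLp P p (cubeMeasure d) := by
  obtain ⟨M, hM⟩ := (isCompact_closedBall (0 : EuclideanSpace ℝ (Fin d)) d).exists_bound_of_continuousOn
    (continuous_of_mem_polyFun hP).continuousOn
  refine MemLp.of_bound (continuous_of_mem_polyFun hP).aestronglyMeasurable M ?_
  filter_upwards [ae_restrict_mem (measurableSet_unitCube d)] with x hx
  exact hM x (mem_closedBall_of_mem_unitCube hx)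

/-- Polynomials as elements of `L_p` of the unit cube. -/
def polyToLp (d l : ℕ) (p : ENNReal) : polyFun d l →ₗ[ℝ] Lp ℝ p (cubeMeasure d) where
  toFun P := (memLp_of_mem_polyFun p P.2).toLp P
  map_add' P R := MemLp.toLp_add (memLp_of_mem_polyFun p P.2) (memLp_of_mem_polyFun p R.2)
  map_smul' c P := MemLp.toLp_const_smul c (memLp_of_mem_polyFun p P.2)

lemma coeFn_polyToLp {d l : ℕ} (p : ENNReal) (P : polyFun d l) :
    polyToLp d l p P =ᵐ[cubeMeasure d] (P : EuclideanSpace ℝ (Fin d) → ℝ) :=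
  MemLp.coeFn_toLp (memLp_of_mem_polyFun p P.2)

/-- A polynomial vanishing almost everywhere on the cube vanishes on the open cube by continuity,
hence everywhere. -/
lemma injective_polyToLp (d l : ℕ) (p : ENNReal) : Function.Injective (polyToLp d l p) := by
  rw [← LinearMap.ker_eq_bot, LinearMap.ker_eq_bot']
  intro P hP
  have h1 : (P : EuclideanSpace ℝ (Fin d) → ℝ) =ᵐ[volume.restrict (openCube d)] 0 := by
    rw [Measure.restrict_congr_set (openCube_ae_eq d)]
    have := coeFn_polyToLp p P
    rw [hP] at this
    exact this.symm.trans (Lp.coeFn_zero _ _ _)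
  have h2 := Measure.eqOn_open_of_ae_eq h1 (isOpen_openCube d)
    (continuous_of_mem_polyFun P.2).continuousOn continuousOn_const
  exact Subtype.ext (polyFun_eq_of_eqOn_pi P.2 fun x hx => h2 hx)

/-- The restriction of polynomials to a compact set. -/
def polyToContinuousMap (d l : ℕ) (K : Set (EuclideanSpace ℝ (Fin d))) :
    polyFun d l →ₗ[ℝ] C(K, ℝ) where
  toFun P := ⟨fun x => (P : EuclideanSpace ℝ (Fin d) → ℝ) x,
    (continuous_of_mem_polyFun P.2).comp continuous_subtype_val⟩
  map_add' _ _ := rfl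
  map_smul' _ _ := rfl

/-- The inverse (Nikolskii) inequality for polynomials on the unit cube. -/
lemma exists_nikolskii_unitCube (d l : ℕ) {p : ℝ} (hp : 1 ≤ p) :
    ∃ C : ENNReal, C ≠ ⊤ ∧ ∀ P ∈ polyFun d l, ∀ x ∈ unitCube d,
      ‖P x‖ₑ ^ p ≤ C * ∫⁻ y in unitCube d, ‖P y‖ₑ ^ p := by
  have hp0 : 0 < p := zero_lt_one.trans_le hp
  have : Fact (1 ≤ ENNReal.ofReal p) := ⟨by simpa using hp⟩
  let T := polyToLp d l (ENNReal.ofReal p)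
  let e := LinearEquiv.ofInjective T (injective_polyToLp d l _)
  have hcpt : CompactSpace (Metric.closedBall (0 : EuclideanSpace ℝ (Fin d)) d) :=
    isCompact_iff_compactSpace.1 (isCompact_closedBall _ _)
  -- The constant comes from the norm of S, which maps the L_p class of a polynomial to its
  -- restriction to a ball containing the cube; S is bounded because its domain is
  -- finite-dimensional.
  let S : LinearMap.range T →L[ℝ] C(Metric.closedBall (0 : EuclideanSpace ℝ (Fin d)) d, ℝ) :=
    LinearMap.toContinuousLinearMap ((polyToContinuousMap d l _).comp e.symm.toLinearMap)
  refine ⟨ENNReal.ofReal ‖S‖ ^ p, ENNReal.rpow_ne_top_of_nonneg hp0.le ENNReal.ofReal_ne_top,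
    fun P hP x hx => ?_⟩
  have hxK := mem_closedBall_of_mem_unitCube hx
  have h1 : ‖P x‖ ≤ ‖S‖ * ‖T ⟨P, hP⟩‖ := by
    have h2 := S.le_opNorm (e ⟨P, hP⟩)
    have h3 : S (e ⟨P, hP⟩) = polyToContinuousMap d l _ ⟨P, hP⟩ := by
      change (polyToContinuousMap d l _) (e.symm (e ⟨P, hP⟩)) = _
      rw [LinearEquiv.symm_apply_apply]
    rw [h3] at h2
    exact (ContinuousMap.norm_coe_le_norm (polyToContinuousMap d l _ ⟨P, hP⟩) ⟨x, hxK⟩).trans h2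
  have h4 : ‖P x‖ₑ ≤ ENNReal.ofReal ‖S‖ * eLpNorm P (ENNReal.ofReal p) (cubeMeasure d) := by
    rw [← eLpNorm_congr_ae (coeFn_polyToLp (ENNReal.ofReal p) ⟨P, hP⟩),
      ← ENNReal.ofReal_toReal (Lp.eLpNorm_ne_top _), ← Lp.norm_def,
      ← ENNReal.ofReal_mul (norm_nonneg S), ← ofReal_norm]
    exact ENNReal.ofReal_le_ofReal h1
  rw [← eLpNorm_rpow_eq_lintegral hp0, ← ENNReal.mul_rpow_of_nonneg _ _ hp0.le]
  exact ENNReal.rpow_le_rpow h4 hp0.le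

lemma exists_nikolskii_cubeAt (d l : ℕ) {p : ℝ} (hp : 1 ≤ p) :
    ∃ C : ENNReal, C ≠ ⊤ ∧ ∀ P ∈ polyFun d l, ∀ (a : EuclideanSpace ℝ (Fin d)) (r : ℝ), 0 < r →
      ∀ x ∈ cubeAt a r,
        ‖P x‖ₑ ^ p ≤ C * (ENNReal.ofReal ((r ^ d)⁻¹) * ∫⁻ y in cubeAt a r, ‖P y‖ₑ ^ p) := by
  obtain ⟨C, hC, h⟩ := exists_nikolskii_unitCube d l hp
  refine ⟨C, hC, fun P hP a r hr x hx => ?_⟩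
  have hx' : a + r • (r⁻¹ • (x - a)) = x := by
    rw [smul_smul, mul_inv_cancel₀ hr.ne', one_smul, add_sub_cancel]
  have h1 := h _ (polyFun_comp_affine hP a r) (r⁻¹ • (x - a))
    ((affine_mem_cubeAt_iff a hr _).1 (by rwa [hx']))
  simp only [hx'] at h1
  rwa [setLIntegral_affine (fun y => ‖P y‖ₑ ^ p) a hr] at h1

/-! ### Dyadic cubes. -/

/-- The lower corner of the dyadic cube of level `j` with index `α`. -/
def dyadicCorner {d : ℕ} (j : ℕ) (α : Fin d → Fin (2 ^ j)) : EuclideanSpace ℝ (Fin d) :=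
  WithLp.toLp 2 fun i => ((2 : ℝ) ^ j)⁻¹ * ((α i : ℕ) : ℝ)

/-- The dyadic subcube of the unit cube of level `j` with index `α`. -/
def dyadicCube {d : ℕ} (j : ℕ) (α : Fin d → Fin (2 ^ j)) : Set (EuclideanSpace ℝ (Fin d)) :=
  cubeAt (dyadicCorner j α) ((2 : ℝ) ^ j)⁻¹

lemma mem_dyadicCube_iff {d j : ℕ} {α : Fin d → Fin (2 ^ j)} {x : EuclideanSpace ℝ (Fin d)} :
    x ∈ dyadicCube j α ↔
      ∀ i, ((α i : ℕ) : ℝ) ≤ 2 ^ j * x i ∧ 2 ^ j * x i < ((α i : ℕ) : ℝ) + 1 := by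
  have h2 : (0 : ℝ) < 2 ^ j := by positivity
  refine forall_congr' fun i => and_congr ?_ ?_
  · simp only [dyadicCorner]
    rw [inv_mul_le_iff₀ h2]
  · simp only [dyadicCorner]
    rw [← mul_add_one, lt_inv_mul_iff₀ h2]

lemma measurableSet_dyadicCube {d j : ℕ} (α : Fin d → Fin (2 ^ j)) :
    MeasurableSet (dyadicCube j α) := measurableSet_cubeAt _ _

lemma dyadicCube_subset_unitCube {d j : ℕ} (α : Fin d → Fin (2 ^ j)) :
    dyadicCube j α ⊆ unitCube d := by
  intro x hx i
  have h2 : (0 : ℝ) < 2 ^ j := by positivity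
  obtain ⟨h3, h4⟩ := mem_dyadicCube_iff.1 hx i
  have h5 : ((α i : ℕ) : ℝ) + 1 ≤ 2 ^ j := by exact_mod_cast (α i).2
  constructor
  · by_contra! h
    have : (0 : ℝ) ≤ ((α i : ℕ) : ℝ) := by positivity
    nlinarith
  · by_contra! h
    nlinarith

lemma dyadicCube_mem_dyadicCubes {d j : ℕ} (α : Fin d → Fin (2 ^ j)) :
    dyadicCube j α ∈ dyadicCubes d := by
  refine ⟨dyadicCube_subset_unitCube α, j, fun i => ((α i : ℕ) : ℤ), ?_⟩
  ext x
  simp only [dyadicCube, cubeAt, dyadicCorner, Set.mem_ofPred_eq, Int.cast_natCast]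
  refine forall_congr' fun i => and_congr Iff.rfl ?_
  rw [mul_add, mul_one]

lemma eq_of_mem_dyadicCube {d j : ℕ} {α β : Fin d → Fin (2 ^ j)}
    {x : EuclideanSpace ℝ (Fin d)} (hα : x ∈ dyadicCube j α) (hβ : x ∈ dyadicCube j β) :
    α = β := by
  funext i
  obtain ⟨h1, h2⟩ := mem_dyadicCube_iff.1 hα i
  obtain ⟨h3, h4⟩ := mem_dyadicCube_iff.1 hβ i
  have h5 : ((α i : ℕ) : ℝ) < (β i : ℕ) + 1 := by linarith
  have h6 : ((β i : ℕ) : ℝ) < (α i : ℕ) + 1 := by linarith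
  norm_cast at h5 h6
  exact Fin.ext (by omega)

lemma exists_mem_dyadicCube {d : ℕ} (j : ℕ) {x : EuclideanSpace ℝ (Fin d)} (hx : x ∈ unitCube d) :
    ∃ α : Fin d → Fin (2 ^ j), x ∈ dyadicCube j α := by
  have h2 : (0 : ℝ) < 2 ^ j := by positivity
  have hlt : ∀ i, ⌊2 ^ j * x i⌋₊ < 2 ^ j := fun i => by
    rw [Nat.floor_lt (mul_nonneg h2.le (hx i).1)]
    push_cast
    nlinarith [(hx i).2]
  refine ⟨fun i => ⟨⌊2 ^ j * x i⌋₊, hlt i⟩, mem_dyadicCube_iff.2 fun i => ⟨?_, ?_⟩⟩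
  · exact Nat.floor_le (mul_nonneg h2.le (hx i).1)
  · exact Nat.lt_floor_add_one _

/-- The index of the dyadic cube of the previous level that contains a given one. -/
def dyadicParent {d j : ℕ} (α : Fin d → Fin (2 ^ (j + 1))) : Fin d → Fin (2 ^ j) :=
  fun i => ⟨(α i : ℕ) / 2, by
    have h1 := (α i).2
    have h2 : 2 ^ (j + 1) = 2 ^ j * 2 := pow_succ 2 j
    omega⟩

lemma dyadicCube_subset_parent {d j : ℕ} (α : Fin d → Fin (2 ^ (j + 1))) :
    dyadicCube (j + 1) α ⊆ dyadicCube j (dyadicParent α) := by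
  intro x hx
  refine mem_dyadicCube_iff.2 fun i => ?_
  obtain ⟨h1, h2⟩ := mem_dyadicCube_iff.1 hx i
  have h3 : 2 * (((α i : ℕ) / 2 : ℕ) : ℝ) ≤ (α i : ℕ) := by exact_mod_cast Nat.mul_div_le _ _
  have h4 : ((α i : ℕ) : ℝ) + 1 ≤ 2 * (((α i : ℕ) / 2 : ℕ) : ℝ) + 2 := by
    norm_cast; omega
  have h5 : (2 : ℝ) ^ (j + 1) * x i = 2 * (2 ^ j * x i) := by ring
  rw [h5] at h1 h2
  simp only [dyadicParent]
  constructor <;> linarith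

lemma dyadicCube_zero {d : ℕ} (α : Fin d → Fin (2 ^ 0)) : dyadicCube 0 α = unitCube d := by
  refine Set.Subset.antisymm (dyadicCube_subset_unitCube α) fun x hx => ?_
  obtain ⟨β, hβ⟩ := exists_mem_dyadicCube 0 hx
  have : α = β := funext fun i => Fin.ext (by have := (α i).2; have := (β i).2; simp at *)
  rwa [this]

lemma measurable_diffAlong {d : ℕ} (k : ℕ) (τ : ℝ) {f : EuclideanSpace ℝ (Fin d) → ℝ}
    (hf : Measurable f) : Measurable (diffAlong k τ f) := by
  have h1 : diffAlong k τ f = fun z => ∑ j : Fin (k + 1),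
      diffCoeff k j * f (mixMap (j * τ) z) := funext fun z => diffAlong_eq_sum _ _ _ _
  rw [h1]
  exact Finset.measurable_fun_sum _ fun j _ =>
    (hf.comp (continuous_mixMap _).measurable).const_mul _

/-! ### Local approximation on one dyadic level. -/

/-- The averaged differences over the dyadic cubes of one level are controlled by the modulus of
continuity. -/
lemma sum_lintegral_diffAlong_le {d k : ℕ} {τ : ℝ} (hτ : 0 < τ) (hkτ : k * τ ≤ 1) {p : ℝ}
    (hp : 1 ≤ p) {f : EuclideanSpace ℝ (Fin d) → ℝ} (hf : Measurable f) (j : ℕ) :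
    ∑ α : Fin d → Fin (2 ^ j), ∫⁻ x in dyadicCube j α, ∫⁻ y in dyadicCube j α,
        ‖diffAlong k τ f (x, y)‖ₑ ^ p ≤
      volume (Metric.closedBall (0 : EuclideanSpace ℝ (Fin d)) (d * ((2 : ℝ) ^ j)⁻¹)) *
        modulusOfContinuity k p f (τ * (d * ((2 : ℝ) ^ j)⁻¹)) ^ p := by
  classical
  have hp0 : 0 < p := zero_lt_one.trans_le hp
  set ρ : ℝ := d * ((2 : ℝ) ^ j)⁻¹ with hρ
  let G : EuclideanSpace ℝ (Fin d) → EuclideanSpace ℝ (Fin d) → ENNReal :=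
    fun x h => ‖(fwdDiff (τ • h))^[k] f x‖ₑ ^ p
  have hG : Measurable (Function.uncurry G) := by
    have h1 : Function.uncurry G = fun z => ‖diffAlong k τ f (z.1, z.1 + z.2)‖ₑ ^ p := by
      funext z; simp [G, Function.uncurry, diffAlong]
    rw [h1]
    exact (((measurable_diffAlong k τ hf).comp (by fun_prop)).enorm).pow_const _
  let I : (Fin d → Fin (2 ^ j)) → EuclideanSpace ℝ (Fin d) → EuclideanSpace ℝ (Fin d) → ENNReal :=
    fun α x h => (dyadicCube j α).indicator (fun _ => 1) x *
      (dyadicCube j α).indicator (fun _ => 1) (x + h)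
  have hI : ∀ α, Measurable (Function.uncurry (I α)) := fun α => by
    have h1 : Measurable ((dyadicCube j α).indicator fun _ => (1 : ENNReal)) :=
      measurable_const.indicator (measurableSet_dyadicCube α)
    exact (h1.comp measurable_fst).mul (h1.comp (measurable_fst.add measurable_snd))
  have hIG : ∀ α, Measurable (Function.uncurry fun x h => I α x h * G x h) :=
    fun α => (hI α).mul hG
  have h1 : ∀ α, ∫⁻ x in dyadicCube j α, ∫⁻ y in dyadicCube j α,
      ‖diffAlong k τ f (x, y)‖ₑ ^ p = ∫⁻ x, ∫⁻ h, I α x h * G x h := fun α => by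
    rw [← lintegral_indicator (measurableSet_dyadicCube α)]
    refine lintegral_congr fun x => ?_
    by_cases hx : x ∈ dyadicCube j α
    · rw [Set.indicator_of_mem hx, ← lintegral_indicator (measurableSet_dyadicCube α),
        ← lintegral_add_left_eq_self _ x]
      refine lintegral_congr fun h => ?_
      by_cases hh : x + h ∈ dyadicCube j α
      · simp [I, hx, hh, G, diffAlong]
      · simp [I, hh]
    · simp [I, hx]
  -- After the substitution y = x + h, disjointness leaves at most one cube for each x. Its diameter
  -- bounds h, and since kτ ≤ 1 convexity keeps every node in it, so x lies in the domain of the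
  -- difference.
  have h2 : ∀ x h, ∑ α, I α x h * G x h ≤ (Metric.closedBall 0 ρ).indicator (fun h =>
      (differenceDomain d k (τ • h)).indicator (fun x => G x h) x) h := by
    intro x h
    by_cases hex : ∃ α, x ∈ dyadicCube j α ∧ x + h ∈ dyadicCube j α
    · obtain ⟨α, hx, hxh⟩ := hex
      rw [Finset.sum_eq_single α]
      · have hh : h ∈ Metric.closedBall 0 ρ := by
          have := norm_sub_le_of_mem_cubeAt hx hxh (by positivity)
          simpa [hρ] using this
        have hd : x ∈ differenceDomain d k (τ • h) := fun i hi => by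
          have h3 : (i : ℝ) * τ ≤ 1 := by
            refine le_trans ?_ hkτ
            have : (i : ℝ) ≤ k := by exact_mod_cast hi
            gcongr
          have := mix_mem_cubeAt hx hxh (s := i * τ) (by positivity) h3
          rw [add_sub_cancel_left, mul_smul, Nat.cast_smul_eq_nsmul] at this
          exact dyadicCube_subset_unitCube α this
        rw [Set.indicator_of_mem hh, Set.indicator_of_mem hd]
        simp [I, hx, hxh]
      · intro β _ hβ
        have : x ∉ dyadicCube j β := fun h' => hβ (eq_of_mem_dyadicCube h' hx)
        simp [I, this]
      · simp
    · rw [Finset.sum_eq_zero]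
      · exact zero_le
      · intro α _
        by_cases hx : x ∈ dyadicCube j α
        · have : x + h ∉ dyadicCube j α := fun h' => hex ⟨α, hx, h'⟩
          simp [I, this]
        · simp [I, hx]
  calc ∑ α, ∫⁻ x in dyadicCube j α, ∫⁻ y in dyadicCube j α, ‖diffAlong k τ f (x, y)‖ₑ ^ p
      = ∑ α, ∫⁻ x, ∫⁻ h, I α x h * G x h := Finset.sum_congr rfl fun α _ => h1 α
    _ = ∫⁻ h : EuclideanSpace ℝ (Fin d), ∫⁻ x, ∑ α, I α x h * G x h := by
        have h3 : ∀ α, ∫⁻ x, ∫⁻ h, I α x h * G x h = ∫⁻ h, ∫⁻ x, I α x h * G x h := fun α =>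
          lintegral_lintegral_swap (hIG α).aemeasurable
        simp_rw [h3]
        rw [← lintegral_finsetSum _ fun α _ => (hIG α).lintegral_prod_left]
        refine lintegral_congr fun h => ?_
        exact (lintegral_finsetSum _ fun α _ => (hIG α).comp measurable_prodMk_right).symm
    _ ≤ ∫⁻ h : EuclideanSpace ℝ (Fin d), (Metric.closedBall 0 ρ).indicator
          (fun _ => modulusOfContinuity k p f (τ * ρ) ^ p) h := by
        refine lintegral_mono fun h => (lintegral_mono fun x => h2 x h).trans ?_
        by_cases hh : h ∈ Metric.closedBall (0 : EuclideanSpace ℝ (Fin d)) ρ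
        · simp only [Set.indicator_of_mem hh]
          refine (lintegral_indicator_le _ _).trans ?_
          rw [← eLpNorm_rpow_eq_lintegral hp0]
          refine ENNReal.rpow_le_rpow ?_ hp0.le
          refine le_iSup₂_of_le (τ • h) ?_ le_rfl
          rw [norm_smul, Real.norm_of_nonneg hτ.le]
          exact mul_le_mul_of_nonneg_left (by simpa using hh) hτ.le
        · simp [Set.indicator_of_notMem hh]
    _ = _ := by
        rw [lintegral_indicator_const Metric.isClosed_closedBall.measurableSet, mul_comm]

lemma modulusOfContinuity_mono {d : ℕ} (k : ℕ) (p : ℝ) (f : EuclideanSpace ℝ (Fin d) → ℝ) :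
    Monotone (modulusOfContinuity k p f) := fun _ _ hst =>
  iSup_mono fun _ => iSup_mono' fun h => ⟨h.trans hst, le_rfl⟩

/-- Simultaneous local polynomial approximation on the dyadic cubes of one level. -/
theorem exists_dyadic_whitney {d : ℕ} (hd : 1 ≤ d) {k : ℕ} (hk : 1 ≤ k) {p : ℝ} (hp : 1 ≤ p) :
    ∃ C : ENNReal, C ≠ ⊤ ∧ ∀ f : EuclideanSpace ℝ (Fin d) → ℝ, Measurable f →
      ∫⁻ x in unitCube d, ‖f x‖ₑ ^ p ≠ ⊤ → ∀ j : ℕ,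
      ∃ P : (Fin d → Fin (2 ^ j)) → EuclideanSpace ℝ (Fin d) → ℝ,
        (∀ α, P α ∈ polyFun d (k - 1)) ∧
        ∑ α, ∫⁻ x in dyadicCube j α, ‖f x - P α x‖ₑ ^ p ≤
          C * modulusOfContinuity k p f (((2 : ℝ) ^ (j + 1))⁻¹) ^ p := by
  have hd' : (1 : ℝ) ≤ d := by exact_mod_cast hd
  have hk' : (1 : ℝ) ≤ k := by exact_mod_cast hk
  -- With τ = 1/(2kd), a cube of level j has steps of length at most 2^(-(j+1))/k. The extra factor
  -- 1/2 puts the modulus at the scale 2^(-(j+1)), so that even level 0 is controlled by the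
  -- seminorm, whose integral stops at t = 1.
  have hτ : (0 : ℝ) < (2 * ((k : ℝ) * (d : ℝ)))⁻¹ := by positivity
  have hkτ : (k : ℝ) * (2 * ((k : ℝ) * (d : ℝ)))⁻¹ ≤ 1 := by
    rw [← div_eq_mul_inv, div_le_one (by positivity)]
    nlinarith
  obtain ⟨C, hC, h⟩ := exists_whitney_cubeAt d hk hτ hkτ hp
  set B := volume (Metric.closedBall (0 : EuclideanSpace ℝ (Fin d)) d) with hB
  refine ⟨C * B, ENNReal.mul_ne_top hC measure_closedBall_lt_top.ne, fun f hf hfin j => ?_⟩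
  have hr : (0 : ℝ) < ((2 : ℝ) ^ j)⁻¹ := by positivity
  choose P hP hPle using fun α : Fin d → Fin (2 ^ j) => h f hf (dyadicCorner j α) _ hr
    (ne_top_of_le_ne_top hfin (lintegral_mono_set (dyadicCube_subset_unitCube α)))
  refine ⟨P, hP, (Finset.sum_le_sum fun α _ => hPle α).trans ?_⟩
  rw [← Finset.mul_sum, ← Finset.mul_sum, mul_assoc]
  refine mul_le_mul_right ?_ C
  refine (mul_le_mul_right (sum_lintegral_diffAlong_le hτ hkτ hp hf j) _).trans ?_
  -- The volume of the ball of admissible h is proportional to r^d and cancels the factor r^(-d) in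
  -- Whitney's inequality.
  have hball : volume (Metric.closedBall (0 : EuclideanSpace ℝ (Fin d)) (d * ((2 : ℝ) ^ j)⁻¹)) =
      ENNReal.ofReal ((((2 : ℝ) ^ j)⁻¹) ^ d) * B := by
    rw [mul_comm, Measure.addHaar_closedBall_mul _ _ hr.le (by positivity),
      finrank_euclideanSpace_fin]
  have hinv : ((((2 : ℝ) ^ j)⁻¹) ^ d)⁻¹ * (((2 : ℝ) ^ j)⁻¹) ^ d = (1 : ℝ) :=
    inv_mul_cancel₀ (by positivity)
  rw [hball, ← mul_assoc, ← mul_assoc, ← ENNReal.ofReal_mul (by positivity), hinv,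
    ENNReal.ofReal_one, one_mul]
  gcongr
  refine modulusOfContinuity_mono k p f ?_
  rw [pow_succ, mul_inv, mul_inv, mul_inv]
  have h3 : (2 : ℝ)⁻¹ * ((k : ℝ)⁻¹ * (d : ℝ)⁻¹) * (d * ((2 : ℝ) ^ j)⁻¹) =
      (k : ℝ)⁻¹ * (((2 : ℝ) ^ j)⁻¹ * 2⁻¹) := by
    field_simp
  rw [h3]
  exact mul_le_of_le_one_left (by positivity) (inv_le_one_of_one_le₀ hk')

/-! ### Discretisation of the Besov seminorm. -/

lemma besovSeminorm_rpow {d : ℕ} {p lam θ : ℝ} (hθ : 0 < θ) (f : EuclideanSpace ℝ (Fin d) → ℝ) :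
    besovSeminorm p lam θ f ^ θ = ∫⁻ t in Set.Ioc (0 : ℝ) 1,
      (modulusOfContinuity (smoothnessOrder lam) p f t / ENNReal.ofReal (t ^ lam)) ^ θ
        / ENNReal.ofReal t := by
  rw [besovSeminorm, ← ENNReal.rpow_mul, one_div_mul_cancel hθ.ne', ENNReal.rpow_one]

/-- The discretised Besov seminorm is controlled by the Besov seminorm. -/
lemma tsum_modulusOfContinuity_le {d : ℕ} {p lam : ℝ} (hp : 0 < p) (hlam : 0 < lam)
    (f : EuclideanSpace ℝ (Fin d) → ℝ) :
    ∑' j : ℕ, ENNReal.ofReal (((2 : ℝ) ^ j) ^ (lam * p)) *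
        modulusOfContinuity (smoothnessOrder lam) p f (((2 : ℝ) ^ (j + 1))⁻¹) ^ p ≤
      2 * besovSeminorm p lam p f ^ p := by
  set ω := modulusOfContinuity (smoothnessOrder lam) p f with hω
  -- On this interval the modulus is at least its value at the left endpoint, and both negative
  -- powers of t are at least their values at the right endpoint. The length 2^(-(j+1)) against 1/t
  -- ≥ 2^j costs the factor 2.
  let J : ℕ → Set ℝ := fun j => Set.Ioc (((2 : ℝ) ^ (j + 1))⁻¹) (((2 : ℝ) ^ j)⁻¹)
  have hanti : Antitone fun j : ℕ => ((2 : ℝ) ^ j)⁻¹ := fun i j hij =>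
    inv_anti₀ (by positivity) (pow_le_pow_right₀ (by norm_num) hij)
  have hdisj : Pairwise (Function.onFun Disjoint J) := hanti.pairwise_disjoint_on_Ioc_succ
  have hsub : (⋃ j, J j) ⊆ Set.Ioc (0 : ℝ) 1 := by
    refine Set.iUnion_subset fun j t ht => ⟨lt_trans (by positivity) ht.1, ht.2.trans ?_⟩
    simpa using hanti (Nat.zero_le j)
  rw [besovSeminorm_rpow hp]
  refine le_trans ?_ (mul_le_mul_right (lintegral_mono_set hsub) 2)
  rw [lintegral_iUnion (fun j => measurableSet_Ioc) hdisj, ← ENNReal.tsum_mul_left]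
  refine ENNReal.tsum_le_tsum fun j => ?_
  have h2 : (0 : ℝ) < 2 ^ j := by positivity
  set c : ENNReal := ENNReal.ofReal (((2 : ℝ) ^ j) ^ (lam * p)) * ω (((2 : ℝ) ^ (j + 1))⁻¹) ^ p *
    ENNReal.ofReal (2 ^ j) with hc
  have hle : ∀ t ∈ J j, c ≤ (ω t / ENNReal.ofReal (t ^ lam)) ^ p / ENNReal.ofReal t := by
    intro t ht
    have ht0 : 0 < t := lt_trans (by positivity) ht.1
    have h3 : ω (((2 : ℝ) ^ (j + 1))⁻¹) ≤ ω t := modulusOfContinuity_mono _ p f ht.1.le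
    have h4 : ENNReal.ofReal (2 ^ j) ≤ (ENNReal.ofReal t)⁻¹ := by
      rw [← ENNReal.ofReal_inv_of_pos ht0]
      exact ENNReal.ofReal_le_ofReal ((le_inv_comm₀ ht0 h2).1 ht.2)
    have h5 : ENNReal.ofReal (((2 : ℝ) ^ j) ^ (lam * p)) ≤
        ((ENNReal.ofReal (t ^ lam))⁻¹) ^ p := by
      rw [← ENNReal.ofReal_inv_of_pos (by positivity), ENNReal.ofReal_rpow_of_pos (by positivity),
        Real.rpow_mul h2.le]
      refine ENNReal.ofReal_le_ofReal (Real.rpow_le_rpow (by positivity) ?_ hp.le)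
      rw [← Real.inv_rpow ht0.le]
      exact Real.rpow_le_rpow h2.le ((le_inv_comm₀ ht0 h2).1 ht.2) hlam.le
    rw [hc, div_eq_mul_inv, div_eq_mul_inv, ENNReal.mul_rpow_of_nonneg _ _ hp.le,
      mul_comm (ω t ^ p)]
    gcongr
  have hvol : 2 * (ENNReal.ofReal (2 ^ j) * volume (J j)) = 1 := by
    rw [Real.volume_Ioc, ← ENNReal.ofReal_mul h2.le, ← ENNReal.ofReal_ofNat 2,
      ← ENNReal.ofReal_mul (by norm_num), ← ENNReal.ofReal_one]
    congr 1
    rw [pow_succ]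
    field_simp
    norm_num
  calc ENNReal.ofReal (((2 : ℝ) ^ j) ^ (lam * p)) * ω (((2 : ℝ) ^ (j + 1))⁻¹) ^ p
      = 2 * (c * volume (J j)) := by
        rw [hc, mul_assoc _ _ (volume (J j)), mul_left_comm, hvol, mul_one]
    _ = 2 * ∫⁻ _ in J j, c := by rw [setLIntegral_const]
    _ ≤ _ := by
        exact mul_le_mul_right (setLIntegral_mono' measurableSet_Ioc hle) 2

lemma measurableSet_differenceDomain (d k : ℕ) (h : EuclideanSpace ℝ (Fin d)) :
    MeasurableSet (differenceDomain d k h) := by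
  have : differenceDomain d k h = ⋂ (j : ℕ) (_ : j ≤ k), (fun x => x + j • h) ⁻¹' unitCube d := by
    ext x; simp [differenceDomain]
  rw [this]
  exact MeasurableSet.iInter fun j => MeasurableSet.iInter fun _ =>
    (measurableSet_unitCube d).preimage (by fun_prop)

/-- Only values inside the cube enter, and translates of null sets are null. This permits passing to
a measurable representative of f. -/
lemma modulusOfContinuity_congr {d k : ℕ} {p : ℝ} {f g : EuclideanSpace ℝ (Fin d) → ℝ}
    (h : f =ᵐ[cubeMeasure d] g) : modulusOfContinuity k p f = modulusOfContinuity k p g := by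
  funext t
  refine iSup_congr fun v => iSup_congr fun _ => eLpNorm_congr_ae ?_
  have h1 : ∀ᵐ z, z ∈ unitCube d → f z = g z := (ae_restrict_iff' (measurableSet_unitCube d)).1 h
  have h2 : ∀ᵐ x : EuclideanSpace ℝ (Fin d), ∀ j : ℕ, x + j • v ∈ unitCube d →
      f (x + j • v) = g (x + j • v) :=
    ae_all_iff.2 fun j => (measurePreserving_add_right volume (j • v)).quasiMeasurePreserving.ae h1
  filter_upwards [ae_restrict_of_ae h2, ae_restrict_mem (measurableSet_differenceDomain d k v)]
    with x hx hxd
  rw [fwdDiff_iter_eq_sum_shift, fwdDiff_iter_eq_sum_shift]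
  refine Finset.sum_congr rfl fun j hj => ?_
  rw [hx j (hxd j (Nat.lt_succ_iff.1 (Finset.mem_range.1 hj)))]

lemma besovSeminorm_congr {d : ℕ} {p lam θ : ℝ} {f g : EuclideanSpace ℝ (Fin d) → ℝ}
    (h : f =ᵐ[cubeMeasure d] g) : besovSeminorm p lam θ f = besovSeminorm p lam θ g := by
  rw [besovSeminorm, besovSeminorm, modulusOfContinuity_congr h]

/-- Sums of polynomials times indicators of arbitrarily indexed sets are piecewise polynomials. -/
lemma sum_indicator_mem_piecewisePolynomials {d l : ℕ} {ι : Type*} (T : Finset ι)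
    (c : ι → Set (EuclideanSpace ℝ (Fin d))) (G : ι → EuclideanSpace ℝ (Fin d) → ℝ)
    (hG : ∀ i, G i ∈ polyFun d l) (Δ : Finset (Set (EuclideanSpace ℝ (Fin d))))
    (hΔ : ∀ i ∈ T, c i ∈ Δ) :
    (fun x => ∑ i ∈ T, (c i).indicator (G i) x) ∈ piecewisePolynomials l Δ := by
  classical
  choose R hR hGR using fun i => mem_polyFun.1 (hG i)
  -- Distinct indices may name the same set, so their polynomials are added.
  refine ⟨fun K => ∑ i ∈ T with c i = K, R i, fun K _ =>
    MvPolynomial.totalDegree_finsetSum_le fun i _ => hR i, funext fun x => ?_⟩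
  rw [← Finset.sum_fiberwise_of_maps_to hΔ]
  refine Finset.sum_congr rfl fun K _ => ?_
  by_cases hx : x ∈ K
  · rw [Set.indicator_of_mem hx, map_sum]
    refine Finset.sum_congr rfl fun i hi => ?_
    rw [Set.indicator_of_mem (by rwa [(Finset.mem_filter.1 hi).2]), hGR i]
  · rw [Set.indicator_of_notMem hx]
    refine Finset.sum_eq_zero fun i hi => ?_
    rw [Set.indicator_of_notMem (by rwa [(Finset.mem_filter.1 hi).2])]

/-! ### The pointwise estimate for sums of small coefficients. -/

/-- A sequence that decays geometrically away from an index has a controlled sum. -/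
lemma tsum_le_of_two_sided_geometric {t : ℕ → ENNReal} {V ρ : ENNReal} (m : ℕ)
    (h1 : ∀ i, t (m + i) ≤ V * ρ ^ i) (h2 : ∀ i < m, t (m - 1 - i) ≤ V * ρ ^ i) :
    ∑' j, t j ≤ V * (2 * (1 - ρ)⁻¹) := by
  have hsplit : ∑' j, t j = ∑ j ∈ Finset.range m, t j + ∑' i, t (i + m) :=
    (Summable.sum_add_tsum_nat_add' (k := m) ENNReal.summable).symm
  rw [hsplit, two_mul, mul_add]
  refine add_le_add ?_ ?_
  · rw [← Finset.sum_range_reflect]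
    calc ∑ i ∈ Finset.range m, t (m - 1 - i) ≤ ∑ i ∈ Finset.range m, V * ρ ^ i :=
          Finset.sum_le_sum fun i hi => h2 i (Finset.mem_range.1 hi)
      _ ≤ ∑' i, V * ρ ^ i := ENNReal.sum_le_tsum _
      _ = _ := by rw [ENNReal.tsum_mul_left, ENNReal.tsum_geometric]
  · calc ∑' i, t (i + m) ≤ ∑' i, V * ρ ^ i :=
          ENNReal.tsum_le_tsum fun i => by rw [add_comm]; exact h1 i
      _ = _ := by rw [ENNReal.tsum_mul_left, ENNReal.tsum_geometric]

/-- The bound b ≤ ε gives terms growing like D^(j/q), and b ≤ B D^(-j) gives terms decaying like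
D^(-jγ) with γ = 1/p - 1/q. The two bounds cross where D^j = B/ε, and there both equal ε^γ B^(1/q).
Splitting at the first m with B ≤ ε D^m leaves two geometric series. -/
lemma tsum_rpow_mul_rpow_le_real {p q D ε B : ℝ} (hp : 0 < p) (hpq : p < q) (hD : 1 < D)
    (hε : 0 < ε) (hB : 0 < B) {b : ℕ → ℝ} (hb0 : ∀ j, 0 ≤ b j) (hbε : ∀ j, b j ≤ ε)
    (hbB : ∀ j, b j * D ^ j ≤ B) :
    ∑' j, ENNReal.ofReal (b j ^ (1 / p) * (D ^ j) ^ (1 / q)) ≤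
      ENNReal.ofReal (ε ^ (1 / p - 1 / q) * B ^ (1 / q)) *
        (2 * (1 - ENNReal.ofReal (max (D⁻¹ ^ (1 / q)) (D⁻¹ ^ (1 / p - 1 / q))))⁻¹) := by
  have hD0 : 0 < D := by linarith
  have hq : 0 < q := by linarith
  have hγ : 0 < 1 / p - 1 / q := sub_pos.2 (one_div_lt_one_div_of_lt hp hpq)
  set γ := 1 / p - 1 / q with hγdef
  set ρ := max (D⁻¹ ^ (1 / q)) (D⁻¹ ^ γ) with hρ
  have hρ0 : 0 ≤ ρ := le_max_of_le_left (by positivity)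
  set V := ε ^ γ * B ^ (1 / q) with hV
  have hV0 : 0 ≤ V := by positivity
  have hex : ∃ m : ℕ, B ≤ ε * D ^ m := by
    obtain ⟨m, hm⟩ := pow_unbounded_of_one_lt (B / ε) hD
    exact ⟨m, by rw [div_lt_iff₀ hε] at hm; linarith⟩
  classical
  have hm := Nat.find_spec hex
  have hmin : ∀ i, i < Nat.find hex → ε * D ^ i < B := fun i hi => not_le.1 (Nat.find_min hex hi)
  set m := Nat.find hex with hmdef
  refine tsum_le_of_two_sided_geometric m (fun i => ?_) fun i hi => ?_
  · rw [← ENNReal.ofReal_pow hρ0, ← ENNReal.ofReal_mul hV0]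
    refine ENNReal.ofReal_le_ofReal ?_
    have h1 : b (m + i) ≤ B * (D⁻¹) ^ (m + i) := by
      rw [inv_pow, ← div_eq_mul_inv, le_div_iff₀ (by positivity)]
      exact hbB _
    have h2 : B * D⁻¹ ^ m ≤ ε := by
      rw [inv_pow, ← div_eq_mul_inv, div_le_iff₀ (by positivity)]
      exact hm
    calc b (m + i) ^ (1 / p) * (D ^ (m + i)) ^ (1 / q)
        ≤ (B * (D⁻¹) ^ (m + i)) ^ (1 / p) * (D ^ (m + i)) ^ (1 / q) := by
          gcongr
          exact hb0 _
      _ = (B * D⁻¹ ^ m) ^ γ * B ^ (1 / q) * (D⁻¹ ^ γ) ^ i := by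
          have e1 : (D ^ (m + i)) ^ (1 / q) = ((D⁻¹) ^ (m + i)) ^ (-(1 / q)) := by
            rw [inv_pow, Real.inv_rpow (by positivity), Real.rpow_neg (by positivity), inv_inv]
          have e2 : (D⁻¹ ^ γ) ^ i = (D⁻¹ ^ i) ^ γ := by
            rw [← Real.rpow_natCast, ← Real.rpow_natCast, ← Real.rpow_mul (by positivity),
              ← Real.rpow_mul (by positivity), mul_comm]
          rw [e1, e2, Real.mul_rpow hB.le (by positivity), Real.mul_rpow hB.le (by positivity),
            mul_assoc, ← Real.rpow_add (by positivity), ← sub_eq_add_neg, ← hγdef, pow_add,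
            Real.mul_rpow (by positivity) (by positivity),
            show 1 / p = γ + 1 / q by rw [hγdef]; ring, Real.rpow_add hB]
          ring
      _ ≤ ε ^ γ * B ^ (1 / q) * ρ ^ i := by
          gcongr
          exact le_max_right _ _
  · rw [← ENNReal.ofReal_pow hρ0, ← ENNReal.ofReal_mul hV0]
    refine ENNReal.ofReal_le_ofReal ?_
    -- The growing half ends at level m - 1, the last one where ε D^j is still below B.
    have h1 := (hmin (m - 1) (by omega)).le
    have h2 : D ^ (m - 1 - i) = D ^ (m - 1) * D⁻¹ ^ i := by
      rw [inv_pow, pow_sub₀ _ hD0.ne' (by omega)]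
    calc b (m - 1 - i) ^ (1 / p) * (D ^ (m - 1 - i)) ^ (1 / q)
        ≤ ε ^ (1 / p) * (D ^ (m - 1 - i)) ^ (1 / q) := by
          gcongr
          · exact hb0 _
          · exact hbε _
      _ = ε ^ γ * (ε * D ^ (m - 1)) ^ (1 / q) * (D⁻¹ ^ (1 / q)) ^ i := by
          have e2 : (D⁻¹ ^ (1 / q)) ^ i = (D⁻¹ ^ i) ^ (1 / q) := by
            rw [← Real.rpow_natCast, ← Real.rpow_natCast, ← Real.rpow_mul (by positivity),
              ← Real.rpow_mul (by positivity), mul_comm]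
          rw [e2, h2, Real.mul_rpow (by positivity) (by positivity),
            Real.mul_rpow hε.le (by positivity), show 1 / p = γ + 1 / q by rw [hγdef]; ring,
            Real.rpow_add hε]
          ring
      _ ≤ ε ^ γ * B ^ (1 / q) * ρ ^ i := by
          gcongr
          exact le_max_left _ _

/-- The pointwise estimate behind best `n`-term approximation: small coefficients whose
contributions grow geometrically. -/
lemma tsum_rpow_mul_rpow_le {p q D : ℝ} (hp : 0 < p) (hpq : p < q) (hD : 1 < D) :
    ∃ C : ENNReal, C ≠ ⊤ ∧ ∀ (ε : ENNReal) (b : ℕ → ENNReal), ε ≠ ⊤ → (∀ j, b j ≤ ε) →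
      (∑' j, b j ^ (1 / p) * ENNReal.ofReal ((D ^ j) ^ (1 / q))) ^ q ≤
        C * (ε ^ (q / p - 1) * ∑' j, b j * ENNReal.ofReal (D ^ j)) := by
  have hq : 0 < q := by linarith
  have hγ : 0 < 1 / p - 1 / q := sub_pos.2 (one_div_lt_one_div_of_lt hp hpq)
  have hqp : 0 < q / p - 1 := by rw [sub_pos, one_lt_div hp]; exact hpq
  have hD0 : 0 < D := by linarith
  set C₀ : ENNReal := 2 * (1 - ENNReal.ofReal (max (D⁻¹ ^ (1 / q)) (D⁻¹ ^ (1 / p - 1 / q))))⁻¹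
    with hC₀
  have hρ1 : max (D⁻¹ ^ (1 / q)) (D⁻¹ ^ (1 / p - 1 / q)) < 1 :=
    max_lt (Real.rpow_lt_one (by positivity) (inv_lt_one_of_one_lt₀ hD) (by positivity))
      (Real.rpow_lt_one (by positivity) (inv_lt_one_of_one_lt₀ hD) hγ)
  have hC₀1 : C₀ ≠ ⊤ := by
    refine ENNReal.mul_ne_top ENNReal.ofNat_ne_top (ENNReal.inv_ne_top.2 ?_)
    rw [Ne, tsub_eq_zero_iff_le, not_le]
    simpa using hρ1
  have hC₀0 : C₀ ≠ 0 := by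
    refine mul_ne_zero two_ne_zero (ENNReal.inv_ne_zero.2 ?_)
    exact ne_top_of_le_ne_top ENNReal.one_ne_top tsub_le_self
  have hC₀q : C₀ ^ q ≠ 0 := by simp [ENNReal.rpow_eq_zero_iff, hC₀0, hC₀1]
  refine ⟨C₀ ^ q, ENNReal.rpow_ne_top_of_nonneg hq.le hC₀1, fun ε b hε hb => ?_⟩
  set B := ∑' j, b j * ENNReal.ofReal (D ^ j) with hBdef
  have hbB : ∀ j, b j * ENNReal.ofReal (D ^ j) ≤ B := fun j => ENNReal.le_tsum j
  have hzero : (∀ j, b j = 0) →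
      (∑' j, b j ^ (1 / p) * ENNReal.ofReal ((D ^ j) ^ (1 / q))) ^ q = 0 := fun h => by
    simp [h, hp, hq]
  -- The real estimate needs 0 < ε, B < ∞. If ε or B is zero, all coefficients vanish; if B is
  -- infinite, so is the right-hand side.
  rcases eq_or_ne ε 0 with rfl | hε0
  · rw [hzero fun j => le_antisymm (hb j) zero_le]
    exact zero_le
  rcases eq_or_ne B 0 with hB0 | hB0
  · rw [hzero fun j => ?_]
    · exact zero_le
    · have := le_antisymm ((hbB j).trans hB0.le) zero_le
      exact (mul_eq_zero.1 this).resolve_right (by simpa using pow_pos hD0 j)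
  rcases eq_or_ne B ⊤ with hBt | hBt
  · rw [hBt, ENNReal.mul_top (by simp [ENNReal.rpow_eq_zero_iff, hε0, hε]), ENNReal.mul_top hC₀q]
    exact le_top
  have hbt : ∀ j, b j ≠ ⊤ := fun j => ne_top_of_le_ne_top hε (hb j)
  have key := tsum_rpow_mul_rpow_le_real hp hpq hD (ENNReal.toReal_pos hε0 hε)
    (ENNReal.toReal_pos hB0 hBt) (b := fun j => (b j).toReal) (fun j => ENNReal.toReal_nonneg)
    (fun j => ENNReal.toReal_mono hε (hb j)) fun j => by
      have := ENNReal.toReal_mono hBt (hbB j)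
      rwa [ENNReal.toReal_mul, ENNReal.toReal_ofReal (by positivity)] at this
  have h1 : ∀ j, ENNReal.ofReal ((b j).toReal ^ (1 / p) * (D ^ j) ^ (1 / q)) =
      b j ^ (1 / p) * ENNReal.ofReal ((D ^ j) ^ (1 / q)) := fun j => by
    rw [ENNReal.ofReal_mul (by positivity), ← ENNReal.ofReal_rpow_of_nonneg ENNReal.toReal_nonneg
      (by positivity), ENNReal.ofReal_toReal (hbt j)]
  simp only [h1] at key
  rw [← hC₀, ENNReal.ofReal_mul (by positivity), ← ENNReal.ofReal_rpow_of_nonneg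
    ENNReal.toReal_nonneg hγ.le, ← ENNReal.ofReal_rpow_of_nonneg ENNReal.toReal_nonneg
    (by positivity), ENNReal.ofReal_toReal hε, ENNReal.ofReal_toReal hBt] at key
  refine (ENNReal.rpow_le_rpow key hq.le).trans (le_of_eq ?_)
  rw [ENNReal.mul_rpow_of_nonneg _ _ hq.le, ENNReal.mul_rpow_of_nonneg _ _ hq.le,
    ← ENNReal.rpow_mul, ← ENNReal.rpow_mul, one_div_mul_cancel hq.ne', ENNReal.rpow_one,
    show (1 / p - 1 / q) * q = q / p - 1 by field_simp, mul_comm]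

/-! ### The multiscale decomposition. -/

lemma sum_lintegral_parent_le {d j : ℕ}
    (H : (Fin d → Fin (2 ^ j)) → EuclideanSpace ℝ (Fin d) → ENNReal) :
    ∑ α : Fin d → Fin (2 ^ (j + 1)), ∫⁻ x in dyadicCube (j + 1) α, H (dyadicParent α) x ≤
      ∑ β, ∫⁻ x in dyadicCube j β, H β x := by
  classical
  rw [← Finset.sum_fiberwise_of_maps_to (s := Finset.univ) (t := Finset.univ)
    (g := fun α : Fin d → Fin (2 ^ (j + 1)) => dyadicParent α) fun _ _ => Finset.mem_univ _]
  refine Finset.sum_le_sum fun β _ => ?_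
  have h1 : ∀ α ∈ (Finset.univ.filter fun α : Fin d → Fin (2 ^ (j + 1)) => dyadicParent α = β),
      ∫⁻ x in dyadicCube (j + 1) α, H (dyadicParent α) x =
        ∫⁻ x in dyadicCube (j + 1) α, H β x := fun α hα => by
    rw [(Finset.mem_filter.1 hα).2]
  rw [Finset.sum_congr rfl h1, ← lintegral_biUnion_finset]
  · refine lintegral_mono_set (Set.iUnion₂_subset fun α hα => ?_)
    exact (Finset.mem_filter.1 hα).2 ▸ dyadicCube_subset_parent α
  · intro α _ α' _ hne
    exact Set.disjoint_left.2 fun x hx hx' => hne (eq_of_mem_dyadicCube hx hx')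
  · exact fun α _ => measurableSet_dyadicCube α

/-- Convergence of local approximations along nested dyadic cubes. -/
lemma ae_tendsto_of_tsum_ne_top {d : ℕ} {p : ℝ} (hp : 0 < p)
    {f : EuclideanSpace ℝ (Fin d) → ℝ} (hf : Measurable f)
    {P : ∀ j : ℕ, (Fin d → Fin (2 ^ j)) → EuclideanSpace ℝ (Fin d) → ℝ}
    (hP : ∀ j α, Measurable (P j α))
    (hsum : ∑' j, ∑ α, ∫⁻ x in dyadicCube j α, ‖f x - P j α x‖ₑ ^ p ≠ ⊤) :
    ∀ᵐ x : EuclideanSpace ℝ (Fin d), ∀ α : ∀ j : ℕ, Fin d → Fin (2 ^ j),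
      (∀ j, x ∈ dyadicCube j (α j)) →
        Filter.Tendsto (fun j => P j (α j) x) Filter.atTop (nhds (f x)) := by
  let H : ℕ → EuclideanSpace ℝ (Fin d) → ENNReal := fun j x =>
    ∑ α, (dyadicCube j α).indicator (fun x => ‖f x - P j α x‖ₑ ^ p) x
  have hmeas : ∀ j α, Measurable
      ((dyadicCube j α).indicator (fun x => ‖f x - P j α x‖ₑ ^ p)) := fun j α =>
    (((hf.sub (hP j α)).enorm).pow_const _).indicator (measurableSet_dyadicCube α)
  have hH : ∀ j, Measurable (H j) := fun j => Finset.measurable_fun_sum _ fun α _ => hmeas j α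
  -- The summed errors are integrable, hence finite almost everywhere, so the errors along the chain
  -- tend to zero.
  have h1 : ∫⁻ x, ∑' j, H j x ≠ ⊤ := by
    rw [lintegral_tsum fun j => (hH j).aemeasurable]
    convert hsum using 3 with j
    rw [lintegral_finsetSum _ fun α _ => hmeas j α]
    exact Finset.sum_congr rfl fun α _ => lintegral_indicator (measurableSet_dyadicCube α) _
  filter_upwards [ae_lt_top (Measurable.tsum hH) h1] with x hx α hα
  have h2 := ENNReal.tendsto_atTop_zero_of_tsum_ne_top hx.ne
  have h3 : ∀ j, H j x = ‖f x - P j (α j) x‖ₑ ^ p := fun j => by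
    simp only [H]
    rw [Finset.sum_eq_single (α j), Set.indicator_of_mem (hα j)]
    · intro β _ hβ
      exact Set.indicator_of_notMem (fun h => hβ (eq_of_mem_dyadicCube h (hα j))) _
    · simp
  simp only [h3] at h2
  have h4 : Filter.Tendsto (fun j => ‖f x - P j (α j) x‖ₑ) Filter.atTop (nhds 0) := by
    have := (ENNReal.continuous_rpow_const (y := p⁻¹)).continuousAt.tendsto.comp h2
    simpa [Function.comp_def, ← ENNReal.rpow_mul, mul_inv_cancel₀ hp.ne', hp] using this
  rw [tendsto_iff_edist_tendsto_0]
  refine h4.congr fun j => ?_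
  rw [edist_comm, edist_eq_enorm_sub]

/-- A multiscale decomposition with polynomial atoms on dyadic cubes whose coefficients are
controlled by the Besov seminorm. -/
theorem exists_multiscale {d : ℕ} (hd : 1 ≤ d) {p q lam : ℝ} (hp : 1 ≤ p) (hpq : p < q)
    (hlam0 : 0 < lam) (hlam : lam / d = 1 / p - 1 / q) (hk : 1 ≤ smoothnessOrder lam) :
    ∃ C : ENNReal, C ≠ ⊤ ∧ ∀ f : EuclideanSpace ℝ (Fin d) → ℝ, Measurable f →
      ∫⁻ x in unitCube d, ‖f x‖ₑ ^ p ≠ ⊤ → besovSeminorm p lam p f ≠ ⊤ →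
      ∃ (P : ∀ j : ℕ, (Fin d → Fin (2 ^ j)) → EuclideanSpace ℝ (Fin d) → ℝ)
        (σ : ∀ j : ℕ, (Fin d → Fin (2 ^ (j + 1))) → ENNReal),
        (∀ j α, P j α ∈ polyFun d (smoothnessOrder lam - 1)) ∧
        (∀ j α, ∀ x ∈ dyadicCube (j + 1) α, ‖P (j + 1) α x - P j (dyadicParent α) x‖ₑ ≤
          σ j α ^ (1 / p) * ENNReal.ofReal ((((2 : ℝ) ^ d) ^ j) ^ (1 / q))) ∧
        ∑' j, ∑ α, σ j α ≤ C * besovSeminorm p lam p f ^ p ∧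
        ∀ᵐ x : EuclideanSpace ℝ (Fin d), ∀ α : ∀ j : ℕ, Fin d → Fin (2 ^ j),
          (∀ j, x ∈ dyadicCube j (α j)) →
            Filter.Tendsto (fun j => P j (α j) x) Filter.atTop (nhds (f x)) := by
  have hp0 : 0 < p := by linarith
  have hq0 : 0 < q := by linarith
  have hd0 : (0 : ℝ) < d := by exact_mod_cast hd
  set k := smoothnessOrder lam with hkdef
  obtain ⟨W, hW, hwhit⟩ := exists_dyadic_whitney hd hk hp
  obtain ⟨K, hK, hnik⟩ := exists_nikolskii_cubeAt d (k - 1) hp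
  set D : ℝ := (2 : ℝ) ^ d with hD
  have hD1 : 1 ≤ D := one_le_pow₀ (by norm_num)
  -- The power of 2 comes from convexity of the p-th power; the last factor 2 counts the errors of
  -- the two levels that an atom compares.
  set c : ENNReal := 2 ^ (p - 1) * (W * 2) with hc
  have hct : c ≠ ⊤ := ENNReal.mul_ne_top
    (ENNReal.rpow_ne_top_of_nonneg (by linarith) ENNReal.ofNat_ne_top)
    (ENNReal.mul_ne_top hW ENNReal.ofNat_ne_top)
  refine ⟨K * ENNReal.ofReal D * c * 2, ENNReal.mul_ne_top (ENNReal.mul_ne_top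
    (ENNReal.mul_ne_top hK ENNReal.ofReal_ne_top) hct) ENNReal.ofNat_ne_top,
    fun f hf hfin hbes => ?_⟩
  choose P hP hPle using hwhit f hf hfin
  have hPm : ∀ j α, Measurable (P j α) := fun j α => (continuous_of_mem_polyFun (hP j α)).measurable
  set ω : ℕ → ENNReal := fun j => modulusOfContinuity k p f (((2 : ℝ) ^ (j + 1))⁻¹) ^ p with hω
  have hωanti : ∀ j, ω (j + 1) ≤ ω j := fun j => by
    refine ENNReal.rpow_le_rpow (modulusOfContinuity_mono _ _ _ ?_) hp0.le
    exact inv_anti₀ (by positivity) (pow_le_pow_right₀ (by norm_num) (Nat.le_succ _))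
  let I : ∀ j : ℕ, (Fin d → Fin (2 ^ (j + 1))) → ENNReal := fun j α =>
    ∫⁻ x in dyadicCube (j + 1) α, ‖P (j + 1) α x - P j (dyadicParent α) x‖ₑ ^ p
  have hIsum : ∀ j, ∑ α, I j α ≤ c * ω j := fun j => by
    have h1 : ∀ α, I j α ≤ 2 ^ (p - 1) *
        ((∫⁻ x in dyadicCube (j + 1) α, ‖f x - P (j + 1) α x‖ₑ ^ p) +
          ∫⁻ x in dyadicCube (j + 1) α, ‖f x - P j (dyadicParent α) x‖ₑ ^ p) := fun α => by
      have hm : Measurable fun x => ‖f x - P (j + 1) α x‖ₑ ^ p :=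
        (hf.sub (hPm _ _)).enorm.pow_const _
      rw [← lintegral_add_left hm, ← lintegral_const_mul' _ _
        (ENNReal.rpow_ne_top_of_nonneg (by linarith) ENNReal.ofNat_ne_top)]
      refine lintegral_mono fun x => ?_
      refine le_trans (ENNReal.rpow_le_rpow ?_ hp0.le)
        (ENNReal.rpow_add_le_mul_rpow_add_rpow _ _ hp)
      have h2 : P (j + 1) α x - P j (dyadicParent α) x =
          (f x - P j (dyadicParent α) x) - (f x - P (j + 1) α x) := by ring
      rw [h2]
      exact enorm_sub_le.trans (add_comm _ _).le
    calc ∑ α, I j α ≤ 2 ^ (p - 1) *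
        ((∑ α, ∫⁻ x in dyadicCube (j + 1) α, ‖f x - P (j + 1) α x‖ₑ ^ p) +
          ∑ α, ∫⁻ x in dyadicCube (j + 1) α, ‖f x - P j (dyadicParent α) x‖ₑ ^ p) := by
          rw [← Finset.sum_add_distrib, Finset.mul_sum]
          exact Finset.sum_le_sum fun α _ => h1 α
      _ ≤ 2 ^ (p - 1) * (W * ω j + W * ω j) := by
          gcongr
          · exact (hPle (j + 1)).trans (mul_le_mul_right (hωanti j) W)
          · exact (sum_lintegral_parent_le fun β x => ‖f x - P j β x‖ₑ ^ p).trans (hPle j)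
      _ = c * ω j := by rw [hc]; ring
  have hωsum := tsum_modulusOfContinuity_le hp0 hlam0 f
  -- This is where λ/d = 1/p - 1/q enters: D^(1 - p/q) = 2^(λp), so the weight of level j is that of
  -- the discrete Besov seminorm.
  have hexp : ∀ j : ℕ, ENNReal.ofReal (D ^ (j + 1)) * ENNReal.ofReal ((D ^ j) ^ (-(p / q))) =
      ENNReal.ofReal D * ENNReal.ofReal (((2 : ℝ) ^ j) ^ (lam * p)) := fun j => by
    rw [← ENNReal.ofReal_mul (by positivity), ← ENNReal.ofReal_mul (by positivity)]
    congr 1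
    have h1 : lam * p = d * (1 - p / q) := by
      have : lam = d * (1 / p - 1 / q) := by rw [← hlam]; field_simp
      rw [this]; field_simp
    have h2 : D ^ j = ((2 : ℝ) ^ j) ^ (d : ℝ) := by
      rw [hD, Real.rpow_natCast, ← pow_mul, ← pow_mul, mul_comm]
    rw [pow_succ, mul_comm (D ^ j) D, mul_assoc, h1, Real.rpow_mul (by positivity), ← h2,
      sub_eq_add_neg, Real.rpow_add (by positivity), Real.rpow_one]
  -- The coefficient is Nikolskii's bound for the p-th power of the atom, divided by the p-th power
  -- of D^(j/q).
  refine ⟨P, fun j α => K * ENNReal.ofReal (D ^ (j + 1)) * I j α *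
    ENNReal.ofReal ((D ^ j) ^ (-(p / q))), hP, fun j α x hx => ?_, ?_, ?_⟩
  · have h1 : (fun x => P (j + 1) α x - P j (dyadicParent α) x) ∈ polyFun d (k - 1) :=
      Submodule.sub_mem _ (hP _ _) (hP _ _)
    have h2 := hnik _ h1 _ _ (by positivity : (0 : ℝ) < ((2 : ℝ) ^ (j + 1))⁻¹) x hx
    have h3 : ((((2 : ℝ) ^ (j + 1))⁻¹) ^ d)⁻¹ = D ^ (j + 1) := by
      rw [inv_pow, inv_inv, hD, ← pow_mul, ← pow_mul, mul_comm]
    rw [h3, ← mul_assoc] at h2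
    have h4 : ENNReal.ofReal ((D ^ j) ^ (-(p / q))) ^ (1 / p) *
        ENNReal.ofReal ((D ^ j) ^ (1 / q)) = 1 := by
      rw [ENNReal.ofReal_rpow_of_pos (by positivity), ← ENNReal.ofReal_mul (by positivity),
        ← Real.rpow_mul (by positivity), ← Real.rpow_add (by positivity), ← ENNReal.ofReal_one]
      congr 1
      rw [show -(p / q) * (1 / p) + 1 / q = 0 by field_simp; ring, Real.rpow_zero]
    rw [ENNReal.mul_rpow_of_nonneg _ _ (by positivity), mul_assoc, h4, mul_one, one_div,
      ENNReal.le_rpow_inv_iff hp0]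
    exact h2
  · calc ∑' j, ∑ α, K * ENNReal.ofReal (D ^ (j + 1)) * I j α *
          ENNReal.ofReal ((D ^ j) ^ (-(p / q)))
        ≤ ∑' j, K * ENNReal.ofReal D * c *
            (ENNReal.ofReal (((2 : ℝ) ^ j) ^ (lam * p)) * ω j) := by
          refine ENNReal.tsum_le_tsum fun j => ?_
          rw [← Finset.sum_mul, ← Finset.mul_sum]
          calc K * ENNReal.ofReal (D ^ (j + 1)) * (∑ α, I j α) * ENNReal.ofReal ((D ^ j) ^ (-(p / q)))
              = K * (ENNReal.ofReal (D ^ (j + 1)) * ENNReal.ofReal ((D ^ j) ^ (-(p / q)))) *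
                  ∑ α, I j α := by ring
            _ ≤ K * (ENNReal.ofReal D * ENNReal.ofReal (((2 : ℝ) ^ j) ^ (lam * p))) *
                  (c * ω j) := by
                rw [hexp]
                exact mul_le_mul_right (hIsum j) _
            _ = _ := by ring
      _ ≤ K * ENNReal.ofReal D * c * (2 * besovSeminorm p lam p f ^ p) := by
          rw [ENNReal.tsum_mul_left]
          exact mul_le_mul_right hωsum _
      _ = _ := by ring
  · refine ae_tendsto_of_tsum_ne_top hp0 hf hPm ?_
    have h1 : ∑' j, ∑ α, ∫⁻ x in dyadicCube j α, ‖f x - P j α x‖ₑ ^ p ≤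
        W * (2 * besovSeminorm p lam p f ^ p) := by
      refine le_trans (ENNReal.tsum_le_tsum fun j => (hPle j).trans ?_)
        (ENNReal.tsum_mul_left.le.trans (mul_le_mul_right hωsum W))
      refine mul_le_mul_right (le_mul_of_one_le_left zero_le ?_) W
      rw [ENNReal.one_le_ofReal]
      exact Real.one_le_rpow (one_le_pow₀ (by norm_num)) (by positivity)
    exact ne_top_of_le_ne_top (ENNReal.mul_ne_top hW (ENNReal.mul_ne_top ENNReal.ofNat_ne_top
      (ENNReal.rpow_ne_top_of_nonneg hp0.le hbes))) h1

/-! ### Thresholding and the approximation error. -/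

/-- Fewer than `N` terms of a convergent series exceed its sum divided by `N`. -/
lemma exists_finset_card_lt_forall_notMem_le {ι : Type*} {s : ι → ENNReal} {N : ℕ} (hN : 1 ≤ N) :
    ∃ Λ : Finset ι, Λ.card < N ∧ ∀ i ∉ Λ, s i ≤ (∑' i, s i) / N := by
  classical
  have hN0 : (N : ENNReal) ≠ 0 := by exact_mod_cast (by omega : N ≠ 0)
  let S : Set ι := {i | (∑' i, s i) / N < s i}
  -- N terms above the threshold would already add up to more than the whole sum.
  have hno : ∀ F : Finset ι, (F : Set ι) ⊆ S → F.card ≠ N := by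
    intro F hF hcard
    have hne : F.Nonempty := Finset.card_pos.1 (by omega)
    have h1 : ∑ _i ∈ F, (∑' i, s i) / N < ∑ i ∈ F, s i :=
      ENNReal.sum_lt_sum_of_nonempty hne fun i hi => hF hi
    rw [Finset.sum_const, hcard, nsmul_eq_mul,
      ENNReal.mul_div_cancel hN0 (ENNReal.natCast_ne_top N)] at h1
    exact absurd (ENNReal.sum_le_tsum F) (not_le.2 h1)
  have hfin : S.Finite := by
    by_contra hinf
    obtain ⟨F, hF, hcard⟩ := Set.Infinite.exists_subset_card_eq hinf N
    exact hno F hF hcard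
  refine ⟨hfin.toFinset, ?_, fun i hi => ?_⟩
  · by_contra! h
    obtain ⟨F, hF, hcard⟩ := Finset.exists_subset_card_eq h
    exact hno F (fun i hi => hfin.mem_toFinset.1 (hF hi)) hcard
  · by_contra! h
    exact hi (hfin.mem_toFinset.2 h)

/-- The sum over a chain of nested dyadic cubes of the selected atoms. -/
lemma sum_indicator_dyadic_eq {d : ℕ} (Λ : Finset (Σ j : ℕ, Fin d → Fin (2 ^ (j + 1))))
    (G : (Σ j : ℕ, Fin d → Fin (2 ^ (j + 1))) → EuclideanSpace ℝ (Fin d) → ℝ)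
    {x : EuclideanSpace ℝ (Fin d)} {α : ∀ j : ℕ, Fin d → Fin (2 ^ j)}
    (hα : ∀ j, x ∈ dyadicCube j (α j)) {J : ℕ} (hJ : ∀ i ∈ Λ, i.1 < J) [DecidableEq
      (Σ j : ℕ, Fin d → Fin (2 ^ (j + 1)))] :
    ∑ i ∈ Λ, (dyadicCube (i.1 + 1) i.2).indicator (G i) x =
      ∑ j ∈ Finset.range J, if (⟨j, α (j + 1)⟩ : Σ j : ℕ, Fin d → Fin (2 ^ (j + 1))) ∈ Λ then
        G ⟨j, α (j + 1)⟩ x else 0 := by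
  let e : ℕ → Σ j : ℕ, Fin d → Fin (2 ^ (j + 1)) := fun j => ⟨j, α (j + 1)⟩
  have he : Function.Injective e := fun i j h => congrArg Sigma.fst h
  rw [← Finset.sum_filter]
  have h1 : ∑ j ∈ (Finset.range J).filter (fun j => e j ∈ Λ), G (e j) x =
      ∑ i ∈ ((Finset.range J).filter fun j => e j ∈ Λ).image e,
        (dyadicCube (i.1 + 1) i.2).indicator (G i) x := by
    rw [Finset.sum_image he.injOn]
    exact Finset.sum_congr rfl fun j _ => (Set.indicator_of_mem (hα (j + 1)) _).symm
  refine Eq.trans ?_ h1.symm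
  refine (Finset.sum_subset (fun i hi => ?_) fun i hi hni => ?_).symm
  · obtain ⟨j, hj, rfl⟩ := Finset.mem_image.1 hi
    exact (Finset.mem_filter.1 hj).2
  · refine Set.indicator_of_notMem (fun hx => hni ?_) _
    have h2 : e i.1 = i := by
      obtain ⟨j, β⟩ := i
      exact congrArg (Sigma.mk j) (eq_of_mem_dyadicCube (hα (j + 1)) hx)
    exact Finset.mem_image.2 ⟨i.1, Finset.mem_filter.2
      ⟨Finset.mem_range.2 (hJ i hi), by rwa [h2]⟩, h2⟩

/-- A cube of level j + 1 has volume at most 2^(-jd), which absorbs the weight. -/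
lemma lintegral_tsum_dyadic_le {d : ℕ} (σ : ∀ j : ℕ, (Fin d → Fin (2 ^ (j + 1))) → ENNReal) :
    ∫⁻ x, ∑' j, ∑ α, (dyadicCube (j + 1) α).indicator
        (fun _ => σ j α * ENNReal.ofReal (((2 : ℝ) ^ d) ^ j)) x ≤ ∑' j, ∑ α, σ j α := by
  have hmeas : ∀ (j : ℕ) (α : Fin d → Fin (2 ^ (j + 1))), Measurable
      ((dyadicCube (j + 1) α).indicator
        (fun _ => σ j α * ENNReal.ofReal (((2 : ℝ) ^ d) ^ j))) := fun j α =>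
    measurable_const.indicator (measurableSet_dyadicCube α)
  rw [lintegral_tsum fun j => (Finset.measurable_fun_sum _ fun α _ => hmeas j α).aemeasurable]
  refine ENNReal.tsum_le_tsum fun j => ?_
  rw [lintegral_finsetSum _ fun α _ => hmeas j α]
  refine Finset.sum_le_sum fun α _ => ?_
  rw [lintegral_indicator_const (measurableSet_dyadicCube α), dyadicCube,
    volume_cubeAt _ (by positivity), mul_assoc, ← ENNReal.ofReal_mul (by positivity)]
  refine mul_le_of_le_one_right zero_le ?_
  rw [← ENNReal.ofReal_one]
  refine ENNReal.ofReal_le_ofReal ?_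
  rw [inv_pow, ← pow_mul, ← pow_mul, ← div_eq_mul_inv, div_le_one (by positivity)]
  exact pow_le_pow_right₀ (by norm_num) (by nlinarith)

/-- Best `n`-term approximation from a multiscale decomposition on dyadic cubes. -/
theorem exists_dyadic_approximation {d l : ℕ} {p q : ℝ} (hd : 1 ≤ d) (hp : 0 < p) (hpq : p < q) :
    ∃ C : ENNReal, C ≠ ⊤ ∧ ∀ (f : EuclideanSpace ℝ (Fin d) → ℝ)
      (P : ∀ j : ℕ, (Fin d → Fin (2 ^ j)) → EuclideanSpace ℝ (Fin d) → ℝ)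
      (σ : ∀ j : ℕ, (Fin d → Fin (2 ^ (j + 1))) → ENNReal),
      (∀ j α, P j α ∈ polyFun d l) →
      (∀ j α, ∀ x ∈ dyadicCube (j + 1) α, ‖P (j + 1) α x - P j (dyadicParent α) x‖ₑ ≤
        σ j α ^ (1 / p) * ENNReal.ofReal ((((2 : ℝ) ^ d) ^ j) ^ (1 / q))) →
      ∑' j, ∑ α, σ j α ≠ ⊤ →
      (∀ᵐ x : EuclideanSpace ℝ (Fin d), ∀ α : ∀ j : ℕ, Fin d → Fin (2 ^ j),
        (∀ j, x ∈ dyadicCube j (α j)) →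
          Filter.Tendsto (fun j => P j (α j) x) Filter.atTop (nhds (f x))) →
      ∀ N : ℕ, 1 ≤ N → ∃ Δ : Finset (Set (EuclideanSpace ℝ (Fin d))),
        (∀ K ∈ Δ, K ∈ dyadicCubes d) ∧ (⋃ K ∈ Δ, K) = unitCube d ∧ Δ.card ≤ N ∧
        ∃ g ∈ piecewisePolynomials l Δ, ∫⁻ x in unitCube d, ‖f x - g x‖ₑ ^ q ≤
          C * (((∑' j, ∑ α, σ j α) / N) ^ (q / p - 1) * ∑' j, ∑ α, σ j α) := by
  classical
  have hq : 0 < q := hp.trans hpq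
  obtain ⟨C, hC, hgeo⟩ := tsum_rpow_mul_rpow_le hp hpq
    (one_lt_pow₀ (one_lt_two : (1 : ℝ) < 2) (by omega : d ≠ 0))
  refine ⟨C, hC, fun f P σ hP hatom hσ hconv N hN => ?_⟩
  set A := ∑' j, ∑ α, σ j α with hA
  let ι := Σ j : ℕ, Fin d → Fin (2 ^ (j + 1))
  have hAι : ∑' i : ι, σ i.1 i.2 = A := by
    rw [hA, ENNReal.tsum_sigma' fun i : ι => σ i.1 i.2]
    simp only [tsum_fintype]
  -- The strict bound on the number of selected atoms leaves room for the unit cube, which carries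
  -- the coarsest polynomial under the index `none` and provides the covering.
  obtain ⟨Λ, hΛcard, hΛ⟩ := exists_finset_card_lt_forall_notMem_le (s := fun i : ι => σ i.1 i.2) hN
  rw [hAι] at hΛ
  have hAN : A / N ≠ ⊤ := ENNReal.div_ne_top hσ (by exact_mod_cast (by omega : N ≠ 0))
  let a : ι → EuclideanSpace ℝ (Fin d) → ℝ := fun i x =>
    P (i.1 + 1) i.2 x - P i.1 (dyadicParent i.2) x
  let G : Option ι → EuclideanSpace ℝ (Fin d) → ℝ := fun o => o.elim (P 0 fun _ => 0) a
  let c : Option ι → Set (EuclideanSpace ℝ (Fin d)) := fun o =>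
    o.elim (unitCube d) fun i => dyadicCube (i.1 + 1) i.2
  have hcQ : ∀ o, c o ∈ dyadicCubes d := by
    rintro (_ | i)
    · have := dyadicCube_mem_dyadicCubes (d := d) (j := 0) fun _ => 0
      rwa [dyadicCube_zero] at this
    · exact dyadicCube_mem_dyadicCubes i.2
  have hG : ∀ o, G o ∈ polyFun d l := by
    rintro (_ | i)
    · exact hP 0 _
    · exact Submodule.sub_mem _ (hP _ _) (hP _ _)
  set T := Finset.insertNone Λ with hT
  refine ⟨T.image c, fun K hK => ?_, ?_, ?_, fun x => ∑ o ∈ T, (c o).indicator (G o) x,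
    sum_indicator_mem_piecewisePolynomials T c G hG _ fun o ho => Finset.mem_image_of_mem c ho, ?_⟩
  · obtain ⟨o, -, rfl⟩ := Finset.mem_image.1 hK
    exact hcQ o
  · refine Set.Subset.antisymm (Set.iUnion₂_subset fun K hK => ?_) fun x hx => ?_
    · obtain ⟨o, -, rfl⟩ := Finset.mem_image.1 hK
      exact (hcQ o).1
    · exact Set.mem_iUnion₂.2 ⟨unitCube d, Finset.mem_image.2
        ⟨none, Finset.none_mem_insertNone, rfl⟩, hx⟩
  · refine Finset.card_image_le.trans ?_
    rw [hT, Finset.card_insertNone]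
    exact hΛcard
  have hpt : ∀ᵐ x ∂volume.restrict (unitCube d),
      ‖f x - ∑ o ∈ T, (c o).indicator (G o) x‖ₑ ^ q ≤ C * ((A / N) ^ (q / p - 1) *
        ∑' j, ∑ α, (dyadicCube (j + 1) α).indicator
          (fun _ => σ j α * ENNReal.ofReal (((2 : ℝ) ^ d) ^ j)) x) := by
    filter_upwards [ae_restrict_of_ae hconv, ae_restrict_mem (measurableSet_unitCube d)]
      with x hx hxQ
    choose α hα using fun j => exists_mem_dyadicCube j hxQ
    have hpar : ∀ j, dyadicParent (α (j + 1)) = α j := fun j =>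
      eq_of_mem_dyadicCube (dyadicCube_subset_parent _ (hα (j + 1))) (hα j)
    let e : ℕ → ι := fun j => ⟨j, α (j + 1)⟩
    -- These are the coefficients of the omitted atoms along the chain of x; by selection they stay
    -- below the threshold.
    let b : ℕ → ENNReal := fun j => if e j ∈ Λ then 0 else σ j (α (j + 1))
    have hb : ∀ j, b j ≤ A / N := fun j => by
      by_cases h : e j ∈ Λ
      · simp [b, h]
      · simp only [b, if_neg h]
        exact hΛ (e j) h
    have hg : ∑ o ∈ T, (c o).indicator (G o) x =
        P 0 (α 0) x + ∑ i ∈ Λ, (dyadicCube (i.1 + 1) i.2).indicator (a i) x := by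
      rw [hT, Finset.sum_insertNone]
      have h0 : (fun _ => 0 : Fin d → Fin (2 ^ 0)) = α 0 :=
        eq_of_mem_dyadicCube (by rwa [dyadicCube_zero]) (hα 0)
      change (unitCube d).indicator (P 0 fun _ => 0) x + _ = _
      rw [Set.indicator_of_mem hxQ, h0]
      rfl
    -- Once J exceeds all selected levels, telescoping up to J and subtracting the approximant
    -- leaves exactly the omitted atoms of the chain.
    have hbound : ∀ J, (∀ i ∈ Λ, i.1 < J) →
        ‖P J (α J) x - ∑ o ∈ T, (c o).indicator (G o) x‖ₑ ≤
          ∑' j, b j ^ (1 / p) * ENNReal.ofReal ((((2 : ℝ) ^ d) ^ j) ^ (1 / q)) := by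
      intro J hJ
      have htel : P J (α J) x = P 0 (α 0) x + ∑ j ∈ Finset.range J, a (e j) x := by
        have h1 : ∀ j, a (e j) x = P (j + 1) (α (j + 1)) x - P j (α j) x := fun j => by
          simp only [a, e, hpar]
        simp only [h1, Finset.sum_range_sub fun j => P j (α j) x]
        ring
      rw [hg, htel, sum_indicator_dyadic_eq Λ a hα hJ, add_sub_add_left_eq_sub,
        ← Finset.sum_sub_distrib]
      refine (enorm_sum_le _ _).trans (le_trans (Finset.sum_le_sum fun j _ => ?_)
        (ENNReal.sum_le_tsum (Finset.range J)))
      by_cases h : e j ∈ Λ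
      · have h' : (⟨j, α (j + 1)⟩ : ι) ∈ Λ := h
        simp [e, h']
      · have h' : (⟨j, α (j + 1)⟩ : ι) ∉ Λ := h
        simp only [h', if_false, sub_zero, b, h]
        exact hatom j (α (j + 1)) x (hα (j + 1))
    have hlim : ‖f x - ∑ o ∈ T, (c o).indicator (G o) x‖ₑ ≤
        ∑' j, b j ^ (1 / p) * ENNReal.ofReal ((((2 : ℝ) ^ d) ^ j) ^ (1 / q)) := by
      refine le_of_tendsto (((hx α hα).sub_const _).enorm) ?_
      filter_upwards [Filter.eventually_gt_atTop (Λ.sup Sigma.fst)] with J hJ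
      exact hbound J fun i hi => (Finset.le_sup (f := Sigma.fst) hi).trans_lt hJ
    refine (ENNReal.rpow_le_rpow hlim hq.le).trans ((hgeo (A / N) b hAN hb).trans ?_)
    refine mul_le_mul_right (mul_le_mul_right (ENNReal.tsum_le_tsum fun j => ?_) _) C
    refine le_trans ?_ (Finset.single_le_sum (fun _ _ => zero_le) (Finset.mem_univ (α (j + 1))))
    rw [Set.indicator_of_mem (hα (j + 1))]
    gcongr
    by_cases h : e j ∈ Λ <;> simp [b, h]
  refine (lintegral_mono_ae hpt).trans ?_
  have hexp : 0 ≤ q / p - 1 := by rw [sub_nonneg, one_le_div hp]; exact hpq.le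
  rw [lintegral_const_mul' _ _ hC,
    lintegral_const_mul' _ _ (ENNReal.rpow_ne_top_of_nonneg hexp hAN)]
  exact mul_le_mul_right (mul_le_mul_right
    ((setLIntegral_le_lintegral _ _).trans (lintegral_tsum_dyadic_le σ)) _) C

/-! ### The approximation theorem. -/

theorem theorem2p3 (d : ℕ) (hd : 2 ≤ d) (p q lam : ℝ) (hp : 1 ≤ p) (hpq : p < q)
    (hlam : lam / (d : ℝ) = 1 / p - 1 / q) :
    ∃ c : ℝ, 0 < c ∧
      ∀ f : EuclideanSpace ℝ (Fin d) → ℝ, MemBesov p lam p f →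
        ∀ N : ℕ, 1 ≤ N →
          ∃ Δ : Finset (Set (EuclideanSpace ℝ (Fin d))),
            (∀ K ∈ Δ, K ∈ dyadicCubes d) ∧
            (⋃ K ∈ Δ, K) = unitCube d ∧
            Δ.card ≤ N ∧
            ∃ g ∈ piecewisePolynomials (smoothnessOrder lam - 1) Δ,
              eLpNorm (fun x => f x - g x) (ENNReal.ofReal q) (volume.restrict (unitCube d)) ≤
                ENNReal.ofReal (c * (N : ℝ) ^ (-(lam / (d : ℝ)))) * besovSeminorm p lam p f := by
  have hp0 : 0 < p := by linarith
  have hq0 : 0 < q := by linarith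
  have hd1 : 1 ≤ d := by omega
  have hd0 : (0 : ℝ) < d := by exact_mod_cast hd1
  have hγ : 0 < 1 / p - 1 / q := sub_pos.2 (one_div_lt_one_div_of_lt hp0 hpq)
  have hlam0 : 0 < lam := by
    rw [← hlam] at hγ
    exact (div_pos_iff_of_pos_right hd0).1 hγ
  have hk : 1 ≤ smoothnessOrder lam := by
    have hmem : lam < ((smoothnessOrder lam : ℕ) : ℝ) := Nat.sInf_mem (exists_nat_gt lam)
    have : (0 : ℝ) < (smoothnessOrder lam : ℕ) := hlam0.trans hmem
    exact_mod_cast this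
  obtain ⟨C₁, hC₁, hdec⟩ := exists_multiscale hd1 hp hpq hlam0 hlam hk
  obtain ⟨C₂, hC₂, happ⟩ := exists_dyadic_approximation (d := d) (l := smoothnessOrder lam - 1)
    hd1 hp0 hpq
  set C : ENNReal := C₂ ^ (1 / q) * C₁ ^ (1 / p) with hCdef
  have hC : C ≠ ⊤ := ENNReal.mul_ne_top (ENNReal.rpow_ne_top_of_nonneg (by positivity) hC₂)
    (ENNReal.rpow_ne_top_of_nonneg (by positivity) hC₁)
  -- Adding one ensures that the constant is strictly positive.
  refine ⟨C.toReal + 1, by positivity, fun f hf N hN => ?_⟩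
  obtain ⟨hfp, hbes⟩ := hf
  -- The preceding results need a measurable function, while f is only almost everywhere equal to
  -- one; neither the seminorm nor the error sees the change.
  set f' := hfp.1.mk f with hf'
  have hff' : f =ᵐ[cubeMeasure d] f' := hfp.1.ae_eq_mk
  have hmeas : Measurable f' := hfp.1.stronglyMeasurable_mk.measurable
  have hfin : ∫⁻ x in unitCube d, ‖f' x‖ₑ ^ p ≠ ⊤ := by
    rw [← eLpNorm_rpow_eq_lintegral hp0, ← eLpNorm_congr_ae hff']
    exact ENNReal.rpow_ne_top_of_nonneg hp0.le hfp.2.ne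
  rw [besovSeminorm_congr hff'] at hbes ⊢
  set b := besovSeminorm p lam p f' with hb
  obtain ⟨P, σ, hP, hatom, hσ, hconv⟩ := hdec f' hmeas hfin hbes.ne
  set A := ∑' j, ∑ α, σ j α with hA
  have hAt : A ≠ ⊤ := ne_top_of_le_ne_top (ENNReal.mul_ne_top hC₁
    (ENNReal.rpow_ne_top_of_nonneg hp0.le hbes.ne)) hσ
  obtain ⟨Δ, hΔ1, hΔ2, hΔ3, g, hg, hle⟩ := happ f' P σ hP hatom hAt hconv N hN
  refine ⟨Δ, hΔ1, hΔ2, hΔ3, g, hg, ?_⟩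
  have hN0 : (0 : ℝ) < N := by exact_mod_cast hN
  have hcongr : eLpNorm (fun x => f x - g x) (ENNReal.ofReal q) (volume.restrict (unitCube d)) =
      eLpNorm (fun x => f' x - g x) (ENNReal.ofReal q) (cubeMeasure d) := by
    refine eLpNorm_congr_ae ?_
    filter_upwards [hff'] with x hx
    rw [hx]
  rw [← eLpNorm_rpow_eq_lintegral hq0, ← hA] at hle
  have hqp : 0 ≤ q / p - 1 := by rw [sub_nonneg, one_le_div hp0]; exact hpq.le
  -- Taking the q-th root turns (A/N)^(q/p - 1) A into N^(-(1/p - 1/q)) A^(1/p).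
  have h1 := ENNReal.rpow_le_rpow hle (by positivity : 0 ≤ 1 / q)
  rw [← ENNReal.rpow_mul, mul_one_div_cancel hq0.ne', ENNReal.rpow_one,
    ENNReal.mul_rpow_of_nonneg _ _ (by positivity), ENNReal.mul_rpow_of_nonneg _ _ (by positivity),
    ← ENNReal.rpow_mul, show (q / p - 1) * (1 / q) = 1 / p - 1 / q by field_simp,
    div_eq_mul_inv A, ENNReal.mul_rpow_of_nonneg _ _ hγ.le] at h1
  have h2 : A ^ (1 / p - 1 / q) * A ^ (1 / q) = A ^ (1 / p) := by
    rw [← ENNReal.rpow_add_of_nonneg _ _ hγ.le (by positivity)]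
    congr 1
    ring
  have h3 : A ^ (1 / p) ≤ C₁ ^ (1 / p) * b := by
    refine (ENNReal.rpow_le_rpow hσ (by positivity)).trans (le_of_eq ?_)
    rw [ENNReal.mul_rpow_of_nonneg _ _ (by positivity), ← ENNReal.rpow_mul,
      mul_one_div_cancel hp0.ne', ENNReal.rpow_one]
  have h4 : ((N : ENNReal)⁻¹) ^ (1 / p - 1 / q) = ENNReal.ofReal ((N : ℝ) ^ (-(lam / (d : ℝ)))) := by
    rw [hlam, Real.rpow_neg hN0.le, ENNReal.ofReal_inv_of_pos (by positivity), ENNReal.inv_rpow,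
      ← ENNReal.ofReal_rpow_of_pos hN0, ENNReal.ofReal_natCast]
  rw [hcongr]
  calc eLpNorm (fun x => f' x - g x) (ENNReal.ofReal q) (cubeMeasure d)
      ≤ C₂ ^ (1 / q) * (A ^ (1 / p - 1 / q) * ((N : ENNReal)⁻¹) ^ (1 / p - 1 / q) *
          A ^ (1 / q)) := h1
    _ = C₂ ^ (1 / q) * ((N : ENNReal)⁻¹) ^ (1 / p - 1 / q) * A ^ (1 / p) := by
        rw [← h2]; ring
    _ ≤ C₂ ^ (1 / q) * ((N : ENNReal)⁻¹) ^ (1 / p - 1 / q) * (C₁ ^ (1 / p) * b) := by gcongr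
    _ = C * ENNReal.ofReal ((N : ℝ) ^ (-(lam / (d : ℝ)))) * b := by rw [h4, hCdef]; ring
    _ ≤ ENNReal.ofReal ((C.toReal + 1) * (N : ℝ) ^ (-(lam / (d : ℝ)))) * b := by
        rw [ENNReal.ofReal_mul (by positivity)]
        gcongr
        rw [← ENNReal.ofReal_toReal hC]
        exact ENNReal.ofReal_le_ofReal (by simp)

end
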